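/- All groupoids are topological groupoids whose topology is second countable, locally compact and Hausdorff. For a groupoid $G$ with unit space $G^{(0)}$, let $r,d:G\to G^{(0)}$ be the range and domain maps; $xy$ is defined when $d(x)=r(y)$. A (continuous left) Haar system on $G$ is a family $\lambda_G^\bullet=\{\lambda_G^u\}_{u\in G^{(0)}}$ of Borel measures on $G$ such that $\lambda_G^u$ is concentrated on $r^{-1}(u)$; $u\mapsto\int f\,d\lambda_G^u$ is finite and continuous for every $0\le f\in C_c(G)$; $\lambda_G^{d(x)}(E)=\lambda_G^{r(x)}(x\cdot(E\cap r^{-1}(d(x))))$ for all $x\in G$ and Borel $E\subseteq G$; and $\lambda_G^u(A)>0$ whenever $A$ is open and meets $r^{-1}(u)$. Given a measure $\mu_G^{(0)}$ on $G^{(0)}$, the induced measure is $\mu_G(E)=\int_{G^{(0)}}\lambda_G^u(E)\,d\mu_G^{(0)}(u)$, and $\mu_G^{-1}(E)=\mu_G(E^{-1})$; $\mu_G^{(0)}$ is quasi-invariant if $\mu_G$ and $\mu_G^{-1}$ are mutually absolutely continuous. A modular function of $\mu_G$ is a Borel groupoid homomorphism $\Delta_G:G\to(0,\infty)$ with $d\mu_G=\Delta_G\,d\mu_G^{-1}$.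 A Haar groupoid is a groupoid with a Haar system and a non-zero quasi-invariant Radon measure on its unit space; a homomorphism of Haar groupoids is a continuous groupoid homomorphism $p:S\to G$ such that $p_*\mu_S$ and $\mu_G$ are mutually absolutely continuous. Let $S,G,T$ be Haar groupoids and let $p:S\to G$, $q:T\to G$ be homomorphisms of Haar groupoids. The weak pullback is the topological groupoid $$P=\{(s,g,t)\in S\times G\times T:\ r(g)=r(p(s)),\ d(g)=r(q(t))\}$$ with the subspace topology, unit space $P^{(0)}=\{(s,g,t)\in S^{(0)}\times G\times T^{(0)}:\ r(g)=p(s),\ d(g)=q(t)\}$, range $r(s,g,t)=(r(s),g,r(t))$, domain $d(s,g,t)=(d(s),p(s)^{-1}gq(t),d(t))$, product $(s,g,t)(\sigma,h,\tau)=(s\sigma,g,t\tau)$ and inverse $(s,g,t)^{-1}=(s^{-1},p(s)^{-1}gq(t),t^{-1})$. Put $\lambda_P^{(s,g,t)}=\lambda_S^s\times\delta_g\times\lambda_T^t$ for $(s,g,t)\in P^{(0)}$. Let $\gamma_p^\bullet=\{\gamma_p^u\}_{u\in G^{(0)}}$ be a family of Borel measures on $S^{(0)}$ with $\gamma_p^u$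 concentrated on $p^{-1}(u)\cap S^{(0)}$, such that $u\mapsto\gamma_p^u(E)$ is Borel for every Borel $E\subseteq S^{(0)}$, every point of $S^{(0)}$ has a neighbourhood $U$ with $\sup_u\gamma_p^u(U)<\infty$, and $\mu_S^{(0)}(E)=\int_{G^{(0)}}\gamma_p^u(E)\,d\mu_G^{(0)}(u)$ for every Borel $E$ (a locally bounded disintegration of $\mu_S^{(0)}$ along $p$); let $\gamma_q^\bullet$ be such a disintegration of $\mu_T^{(0)}$ with respect to $\mu_G^{(0)}$ along $q$. For $x\in G$ let $\eta^x=\gamma_p^{r(x)}\times\delta_x\times\gamma_q^{d(x)}$, a measure on $P^{(0)}$. Then the formula $\mu_P^{(0)}(B)=\int_G\eta^x(B)\,d\mu_G(x)$ for Borel $B\subseteq P^{(0)}$ defines a measure $\mu_P^{(0)}$ on $P^{(0)}$, the formula $\mu_P(E)=\int_{P^{(0)}}\lambda_P^v(E)\,d\mu_P^{(0)}(v)$ for Borel $E\subseteq P$ defines a measure $\mu_P$ on $P$, and $\mu_P^{(0)}$ is quasi-invariant with respect to $\lambda_P^\bullet$: the measures $\mu_P$ and $\mu_P^{-1}$ are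 mutually absolutely continuous. Moreover, if $\Delta_S,\Delta_G,\Delta_T$ are modular functions of $\mu_S,\mu_G,\mu_T$, then $$\Delta_P(\sigma,x,\tau)=\frac{\Delta_S(\sigma)\,\Delta_T(\tau)}{\Delta_G(q(\tau))}$$ is a modular function of $\mu_P$. -/

import Mathlib

open MeasureTheory Topology
open scoped ENNReal NNReal

noncomputable section

/-! ### Topological groupoids -/

/-- A topological groupoid with space of arrows `G` and space of units `G0`. Here `r` is the range
map, `d` is the domain map, and `mul x y` is defined exactly when `d x = r y`. The map `unit`
identifies `G0` with the subspace of identity arrows of `G`: since `r (unit u) = u` and both maps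
are continuous, `unit` is a topological embedding. -/
structure TopGroupoid (G0 G : Type*) [TopologicalSpace G0] [TopologicalSpace G] where
  r : G → G0
  d : G → G0
  unit : G0 → G
  inv : G → G
  mul : (x y : G) → d x = r y → G
  r_unit : ∀ u, r (unit u) = u
  d_unit : ∀ u, d (unit u) = u
  r_inv : ∀ x, r (inv x) = d x
  d_inv : ∀ x, d (inv x) = r x
  r_mul : ∀ x y h, r (mul x y h) = r x
  d_mul : ∀ x y h, d (mul x y h) = d y
  mul_assoc : ∀ x y z (h₁ : d x = r y) (h₂ : d y = r z),
    mul (mul x y h₁) z ((d_mul x y h₁).trans h₂) = mul x (mul y z h₂) (h₁.trans (r_mul y z h₂).symm)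
  unit_mul : ∀ x, mul (unit (r x)) x (d_unit (r x)) = x
  mul_unit : ∀ x, mul x (unit (d x)) (r_unit (d x)).symm = x
  inv_mul : ∀ x, mul (inv x) x (d_inv x) = unit (d x)
  mul_inv : ∀ x, mul x (inv x) (r_inv x).symm = unit (r x)
  continuous_r : Continuous r
  continuous_d : Continuous d
  continuous_unit : Continuous unit
  continuous_inv : Continuous inv
  continuous_mul : Continuous fun z : {z : G × G // d z.1 = r z.2} => mul z.1.1 z.1.2 z.2

namespace TopGroupoid

section Basic

variable {G0 G : Type*} [TopologicalSpace G0] [TopologicalSpace G] (𝒢 : TopGroupoid G0 G)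

theorem mul_congr {x x' y y' : G} (hx : x = x') (hy : y = y') (h : 𝒢.d x = 𝒢.r y)
    (h' : 𝒢.d x' = 𝒢.r y') : 𝒢.mul x y h = 𝒢.mul x' y' h' := by
  subst hx; subst hy; rfl

theorem unit_mul' {u : G0} {x : G} (h : 𝒢.d (𝒢.unit u) = 𝒢.r x) :
    𝒢.mul (𝒢.unit u) x h = x := by
  have hu : u = 𝒢.r x := (𝒢.d_unit u).symm.trans h
  subst hu
  exact 𝒢.unit_mul x

theorem mul_unit' {u : G0} {x : G} (h : 𝒢.d x = 𝒢.r (𝒢.unit u)) :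
    𝒢.mul x (𝒢.unit u) h = x := by
  have hu : u = 𝒢.d x := ((h.trans (𝒢.r_unit u))).symm
  subst hu
  exact 𝒢.mul_unit x

/-- A left inverse is the inverse. -/
theorem eq_inv_of_mul {x y : G} (h : 𝒢.d y = 𝒢.r x) (e : 𝒢.mul y x h = 𝒢.unit (𝒢.d x)) :
    y = 𝒢.inv x := by
  have h2 := 𝒢.mul_assoc y x (𝒢.inv x) h (𝒢.r_inv x).symm
  have hyr : 𝒢.r (𝒢.unit (𝒢.d x)) = 𝒢.r y := by rw [← e, 𝒢.r_mul]
  have h3 : 𝒢.mul (𝒢.mul y x h) (𝒢.inv x) ((𝒢.d_mul _ _ _).trans (𝒢.r_inv x).symm)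
      = 𝒢.inv x := by
    rw [𝒢.mul_congr e rfl _ ((𝒢.d_unit _).trans (𝒢.r_inv x).symm)]
    exact 𝒢.unit_mul' _
  have h4 : 𝒢.mul y (𝒢.mul x (𝒢.inv x) (𝒢.r_inv x).symm) (h.trans (𝒢.r_mul _ _ _).symm) = y := by
    rw [𝒢.mul_congr rfl (𝒢.mul_inv x) _ (h.trans (𝒢.r_unit _).symm)]
    exact 𝒢.mul_unit' _
  rw [← h4, ← h2, h3]

theorem inv_unit (u : G0) : 𝒢.inv (𝒢.unit u) = 𝒢.unit u := by
  symm
  apply 𝒢.eq_inv_of_mul ((𝒢.d_unit u).trans (𝒢.r_unit u).symm)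
  rw [𝒢.unit_mul', 𝒢.d_unit]

theorem inv_inv (x : G) : 𝒢.inv (𝒢.inv x) = x := by
  symm
  apply 𝒢.eq_inv_of_mul (𝒢.r_inv x).symm
  rw [𝒢.mul_inv, 𝒢.d_inv]

/-- `a⁻¹ g b`. -/
def conj (a g b : G) (h₁ : 𝒢.r g = 𝒢.r a) (h₂ : 𝒢.d g = 𝒢.r b) : G :=
  𝒢.mul (𝒢.mul (𝒢.inv a) g ((𝒢.d_inv a).trans h₁.symm)) b ((𝒢.d_mul _ _ _).trans h₂)

theorem r_conj (a g b : G) (h₁ : 𝒢.r g = 𝒢.r a) (h₂ : 𝒢.d g = 𝒢.r b) :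
    𝒢.r (𝒢.conj a g b h₁ h₂) = 𝒢.d a := by
  rw [conj, 𝒢.r_mul, 𝒢.r_mul, 𝒢.r_inv]

theorem d_conj (a g b : G) (h₁ : 𝒢.r g = 𝒢.r a) (h₂ : 𝒢.d g = 𝒢.r b) :
    𝒢.d (𝒢.conj a g b h₁ h₂) = 𝒢.d b := by
  rw [conj, 𝒢.d_mul]

theorem conj_congr {a a' g g' b b' : G} (ha : a = a') (hg : g = g') (hb : b = b')
    (h₁ : 𝒢.r g = 𝒢.r a) (h₂ : 𝒢.d g = 𝒢.r b) (h₁' : 𝒢.r g' = 𝒢.r a') (h₂' : 𝒢.d g' = 𝒢.r b') :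
    𝒢.conj a g b h₁ h₂ = 𝒢.conj a' g' b' h₁' h₂' := by
  subst ha; subst hg; subst hb; rfl

theorem conj_unit (u v : G0) (g : G) (h₁ : 𝒢.r g = 𝒢.r (𝒢.unit u))
    (h₂ : 𝒢.d g = 𝒢.r (𝒢.unit v)) : 𝒢.conj (𝒢.unit u) g (𝒢.unit v) h₁ h₂ = g := by
  have hd : 𝒢.d (𝒢.unit u) = 𝒢.r g := by rw [h₁, 𝒢.r_unit, 𝒢.d_unit]
  rw [conj, 𝒢.mul_unit', 𝒢.mul_congr (𝒢.inv_unit u) rfl _ hd, 𝒢.unit_mul']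

theorem inv_mul_rev (a b : G) (h : 𝒢.d a = 𝒢.r b) :
    𝒢.inv (𝒢.mul a b h) =
      𝒢.mul (𝒢.inv b) (𝒢.inv a) ((𝒢.d_inv b).trans (h.symm.trans (𝒢.r_inv a).symm)) := by
  symm
  have h₁ : 𝒢.d (𝒢.inv b) = 𝒢.r (𝒢.inv a) := (𝒢.d_inv b).trans (h.symm.trans (𝒢.r_inv a).symm)
  have h₂ : 𝒢.d (𝒢.inv a) = 𝒢.r (𝒢.mul a b h) := (𝒢.d_inv a).trans (𝒢.r_mul _ _ _).symm
  apply 𝒢.eq_inv_of_mul ((𝒢.d_mul _ _ _).trans h₂)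
  rw [𝒢.mul_assoc _ _ _ h₁ h₂]
  have e : 𝒢.mul (𝒢.inv a) (𝒢.mul a b h) h₂ = b := by
    rw [← 𝒢.mul_assoc (𝒢.inv a) a b (𝒢.d_inv a) h,
      𝒢.mul_congr (𝒢.inv_mul a) rfl _ ((𝒢.d_unit _).trans h), 𝒢.unit_mul']
  rw [𝒢.mul_congr rfl e _ (𝒢.d_inv b), 𝒢.inv_mul, 𝒢.d_mul]

theorem conj_mul (a a' g b b' : G) (ha : 𝒢.d a = 𝒢.r a') (hb : 𝒢.d b = 𝒢.r b')
    (h₁ : 𝒢.r g = 𝒢.r a) (h₂ : 𝒢.d g = 𝒢.r b) :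
    𝒢.conj (𝒢.mul a a' ha) g (𝒢.mul b b' hb) (h₁.trans (𝒢.r_mul _ _ _).symm)
        (h₂.trans (𝒢.r_mul _ _ _).symm) =
      𝒢.conj a' (𝒢.conj a g b h₁ h₂) b' ((𝒢.r_conj _ _ _ _ _).trans ha)
        ((𝒢.d_conj _ _ _ _ _).trans hb) := by
  have k₁ : 𝒢.d (𝒢.inv a') = 𝒢.r (𝒢.inv a) := (𝒢.d_inv a').trans (ha.symm.trans (𝒢.r_inv a).symm)
  have k₂ : 𝒢.d (𝒢.inv a) = 𝒢.r g := (𝒢.d_inv a).trans h₁.symm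
  have k₃ : 𝒢.d (𝒢.mul (𝒢.inv a) g k₂) = 𝒢.r b := (𝒢.d_mul _ _ _).trans h₂
  have k₄ : 𝒢.d (𝒢.inv a') = 𝒢.r (𝒢.mul (𝒢.inv a) g k₂) := k₁.trans (𝒢.r_mul _ _ _).symm
  have e : 𝒢.mul (𝒢.inv (𝒢.mul a a' ha)) g
      ((𝒢.d_inv _).trans ((𝒢.r_mul _ _ _).trans h₁.symm)) =
      𝒢.mul (𝒢.inv a') (𝒢.mul (𝒢.inv a) g k₂) k₄ := by
    rw [𝒢.mul_congr (𝒢.inv_mul_rev a a' ha) rfl _ ((𝒢.d_mul _ _ _).trans k₂),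
      𝒢.mul_assoc _ _ _ k₁ k₂]
  unfold conj
  rw [𝒢.mul_congr e rfl _ ((𝒢.d_mul _ _ _).trans (k₃.trans (𝒢.r_mul b b' hb).symm)),
    ← 𝒢.mul_assoc _ b b' ((𝒢.d_mul _ _ _).trans k₃) hb]
  exact 𝒢.mul_congr (𝒢.mul_assoc _ _ _ k₄ k₃) rfl _ _

end Basic

/-- Continuous homomorphisms of topological groupoids; `obj` is the restriction to units. -/
structure Hom {S0 S G0 G : Type*} [TopologicalSpace S0] [TopologicalSpace S]
    [TopologicalSpace G0] [TopologicalSpace G] (𝒮 : TopGroupoid S0 S) (𝒢 : TopGroupoid G0 G) where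
  map : S → G
  obj : S0 → G0
  r_map : ∀ x, 𝒢.r (map x) = obj (𝒮.r x)
  d_map : ∀ x, 𝒢.d (map x) = obj (𝒮.d x)
  map_mul : ∀ x y (h : 𝒮.d x = 𝒮.r y), map (𝒮.mul x y h) =
    𝒢.mul (map x) (map y) ((d_map x).trans ((congrArg obj h).trans (r_map y).symm))
  continuous_map : Continuous map

section HomFacts

variable {S0 S G0 G : Type*} [TopologicalSpace S0] [TopologicalSpace S]
    [TopologicalSpace G0] [TopologicalSpace G] {𝒮 : TopGroupoid S0 S} {𝒢 : TopGroupoid G0 G}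

theorem Hom.map_unit (p : Hom 𝒮 𝒢) (u : S0) : p.map (𝒮.unit u) = 𝒢.unit (p.obj u) := by
  have hd : 𝒮.d (𝒮.unit u) = 𝒮.r (𝒮.unit u) := (𝒮.d_unit u).trans (𝒮.r_unit u).symm
  have h := p.map_mul (𝒮.unit u) (𝒮.unit u) hd
  rw [𝒮.unit_mul'] at h
  set a := p.map (𝒮.unit u) with ha
  have hda : 𝒢.d a = p.obj u := by rw [ha, p.d_map, 𝒮.d_unit]
  have hra : 𝒢.r a = p.obj u := by rw [ha, p.r_map, 𝒮.r_unit]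
  have hdr : 𝒢.d a = 𝒢.r a := hda.trans hra.symm
  have e := 𝒢.mul_assoc (𝒢.inv a) a a (𝒢.d_inv a) hdr
  rw [𝒢.mul_congr (𝒢.inv_mul a) rfl _ ((𝒢.d_unit _).trans hdr), 𝒢.unit_mul',
    𝒢.mul_congr rfl h.symm _ (𝒢.d_inv a), 𝒢.inv_mul, hda] at e
  exact e

end HomFacts

/-! ### The weak pullback -/

section WeakPullback

variable {S0 S G0 G T0 T : Type*} [TopologicalSpace S0] [TopologicalSpace S]
  [TopologicalSpace G0] [TopologicalSpace G] [TopologicalSpace T0] [TopologicalSpace T]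
  {𝒮 : TopGroupoid S0 S} {𝒢 : TopGroupoid G0 G} {𝒯 : TopGroupoid T0 T}

/-- The arrows `(s, g, t)` of the weak pullback `P`, with the subspace topology (and the subspace
measurable structure) of `S × G × T`. -/
abbrev WPB (p : Hom 𝒮 𝒢) (q : Hom 𝒯 𝒢) : Type _ :=
  {x : S × G × T // 𝒢.r x.2.1 = 𝒢.r (p.map x.1) ∧ 𝒢.d x.2.1 = 𝒢.r (q.map x.2.2)}

/-- The unit space of the weak pullback: triples `(s, g, t)` of units `s`, `t` and an arrow `g`
with range `p s` and domain `q t`. -/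
abbrev WPB0 (p : Hom 𝒮 𝒢) (q : Hom 𝒯 𝒢) : Type _ :=
  {v : S0 × G × T0 // 𝒢.r v.2.1 = p.obj v.1 ∧ 𝒢.d v.2.1 = q.obj v.2.2}

/-- `p(s)⁻¹ g q(t)` for `(s, g, t)` in the weak pullback. -/
def wpbMid (p : Hom 𝒮 𝒢) (q : Hom 𝒯 𝒢) (x : WPB p q) : G :=
  𝒢.conj (p.map x.1.1) x.1.2.1 (q.map x.1.2.2) x.2.1 x.2.2

theorem r_wpbMid (p : Hom 𝒮 𝒢) (q : Hom 𝒯 𝒢) (x : WPB p q) :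
    𝒢.r (wpbMid p q x) = p.obj (𝒮.d x.1.1) :=
  (𝒢.r_conj _ _ _ x.2.1 x.2.2).trans (p.d_map _)

theorem d_wpbMid (p : Hom 𝒮 𝒢) (q : Hom 𝒯 𝒢) (x : WPB p q) :
    𝒢.d (wpbMid p q x) = q.obj (𝒯.d x.1.2.2) :=
  (𝒢.d_conj _ _ _ x.2.1 x.2.2).trans (q.d_map _)

theorem continuous_wpbMid (p : Hom 𝒮 𝒢) (q : Hom 𝒯 𝒢) : Continuous (wpbMid p q) := by
  have hp : Continuous fun x : WPB p q => p.map x.1.1 :=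
    p.continuous_map.comp (continuous_fst.comp continuous_subtype_val)
  have hq : Continuous fun x : WPB p q => q.map x.1.2.2 :=
    q.continuous_map.comp (continuous_snd.comp (continuous_snd.comp continuous_subtype_val))
  have hg : Continuous fun x : WPB p q => x.1.2.1 :=
    continuous_fst.comp (continuous_snd.comp continuous_subtype_val)
  have h1 : Continuous fun x : WPB p q => 𝒢.mul (𝒢.inv (p.map x.1.1)) x.1.2.1
      ((𝒢.d_inv _).trans x.2.1.symm) :=
    𝒢.continuous_mul.comp (Continuous.subtype_mk ((𝒢.continuous_inv.comp hp).prodMk hg)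
      fun x => (𝒢.d_inv _).trans x.2.1.symm)
  exact 𝒢.continuous_mul.comp (Continuous.subtype_mk (h1.prodMk hq)
    fun x => (𝒢.d_mul _ _ _).trans x.2.2)

/-- The weak pullback `P` as a topological groupoid:
`r(s,g,t) = (r s, g, r t)`, `d(s,g,t) = (d s, p(s)⁻¹ g q(t), d t)`,
`(s,g,t)(σ,h,τ) = (sσ, g, tτ)` and `(s,g,t)⁻¹ = (s⁻¹, p(s)⁻¹ g q(t), t⁻¹)`. -/
def weakPullback (p : Hom 𝒮 𝒢) (q : Hom 𝒯 𝒢) : TopGroupoid (WPB0 p q) (WPB p q) where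
  r x := ⟨(𝒮.r x.1.1, x.1.2.1, 𝒯.r x.1.2.2),
    x.2.1.trans (p.r_map _), x.2.2.trans (q.r_map _)⟩
  d x := ⟨(𝒮.d x.1.1, wpbMid p q x, 𝒯.d x.1.2.2),
    r_wpbMid p q x, d_wpbMid p q x⟩
  unit v := ⟨(𝒮.unit v.1.1, v.1.2.1, 𝒯.unit v.1.2.2), by
    constructor
    · rw [p.r_map, 𝒮.r_unit]; exact v.2.1
    · rw [q.r_map, 𝒯.r_unit]; exact v.2.2⟩
  inv x := ⟨(𝒮.inv x.1.1, wpbMid p q x, 𝒯.inv x.1.2.2), by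
    constructor
    · rw [p.r_map, 𝒮.r_inv]; exact r_wpbMid p q x
    · rw [q.r_map, 𝒯.r_inv]; exact d_wpbMid p q x⟩
  mul x y h := ⟨(𝒮.mul x.1.1 y.1.1 (congrArg (fun v => v.1.1) h), x.1.2.1,
      𝒯.mul x.1.2.2 y.1.2.2 (congrArg (fun v => v.1.2.2) h)),
    (x.2.1.trans (p.r_map _)).trans
      ((congrArg p.obj (𝒮.r_mul _ _ _).symm).trans (p.r_map _).symm),
    (x.2.2.trans (q.r_map _)).trans
      ((congrArg q.obj (𝒯.r_mul _ _ _).symm).trans (q.r_map _).symm)⟩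
  r_unit v := Subtype.ext (Prod.ext (𝒮.r_unit _) (Prod.ext rfl (𝒯.r_unit _)))
  d_unit v := by
    refine Subtype.ext (Prod.ext (𝒮.d_unit _) (Prod.ext ?_ (𝒯.d_unit _)))
    have k₁ : 𝒢.r v.1.2.1 = 𝒢.r (p.map (𝒮.unit v.1.1)) := by
      rw [p.r_map, 𝒮.r_unit]; exact v.2.1
    have k₂ : 𝒢.d v.1.2.1 = 𝒢.r (q.map (𝒯.unit v.1.2.2)) := by
      rw [q.r_map, 𝒯.r_unit]; exact v.2.2
    exact (𝒢.conj_congr (p.map_unit _) rfl (q.map_unit _) k₁ k₂ (v.2.1.trans (𝒢.r_unit _).symm)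
      (v.2.2.trans (𝒢.r_unit _).symm)).trans (𝒢.conj_unit _ _ _ _ _)
  r_inv x := Subtype.ext (Prod.ext (𝒮.r_inv _) (Prod.ext rfl (𝒯.r_inv _)))
  d_inv x := by
    refine Subtype.ext (Prod.ext (𝒮.d_inv _) (Prod.ext ?_ (𝒯.d_inv _)))
    have k₁ : 𝒢.d (p.map x.1.1) = 𝒢.r (p.map (𝒮.inv x.1.1)) := by
      rw [p.d_map, p.r_map, 𝒮.r_inv]
    have k₂ : 𝒢.d (q.map x.1.2.2) = 𝒢.r (q.map (𝒯.inv x.1.2.2)) := by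
      rw [q.d_map, q.r_map, 𝒯.r_inv]
    have e₁ : 𝒢.mul (p.map x.1.1) (p.map (𝒮.inv x.1.1)) k₁ = 𝒢.unit (p.obj (𝒮.r x.1.1)) := by
      rw [← p.map_unit, ← 𝒮.mul_inv, p.map_mul]
    have e₂ : 𝒢.mul (q.map x.1.2.2) (q.map (𝒯.inv x.1.2.2)) k₂
        = 𝒢.unit (q.obj (𝒯.r x.1.2.2)) := by
      rw [← q.map_unit, ← 𝒯.mul_inv, q.map_mul]
    refine (𝒢.conj_mul _ _ _ _ _ k₁ k₂ x.2.1 x.2.2).symm.trans ?_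
    exact (𝒢.conj_congr e₁ rfl e₂ _ _ (x.2.1.trans ((p.r_map _).trans (𝒢.r_unit _).symm))
        (x.2.2.trans ((q.r_map _).trans (𝒢.r_unit _).symm))).trans (𝒢.conj_unit _ _ _ _ _)
  r_mul x y h := Subtype.ext (Prod.ext (𝒮.r_mul _ _ _) (Prod.ext rfl (𝒯.r_mul _ _ _)))
  d_mul x y h := by
    refine Subtype.ext (Prod.ext (𝒮.d_mul _ _ _) (Prod.ext ?_ (𝒯.d_mul _ _ _)))
    have hs : 𝒮.d x.1.1 = 𝒮.r y.1.1 := congrArg (fun v => v.1.1) h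
    have ht : 𝒯.d x.1.2.2 = 𝒯.r y.1.2.2 := congrArg (fun v => v.1.2.2) h
    have hg : wpbMid p q x = y.1.2.1 := congrArg (fun v => v.1.2.1) h
    have k₁ : 𝒢.d (p.map x.1.1) = 𝒢.r (p.map y.1.1) := by rw [p.d_map, p.r_map, hs]
    have k₂ : 𝒢.d (q.map x.1.2.2) = 𝒢.r (q.map y.1.2.2) := by rw [q.d_map, q.r_map, ht]
    have k₃ : 𝒢.r x.1.2.1 = 𝒢.r (p.map (𝒮.mul x.1.1 y.1.1 hs)) := by
      rw [p.r_map, 𝒮.r_mul]; exact x.2.1.trans (p.r_map _)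
    have k₄ : 𝒢.d x.1.2.1 = 𝒢.r (q.map (𝒯.mul x.1.2.2 y.1.2.2 ht)) := by
      rw [q.r_map, 𝒯.r_mul]; exact x.2.2.trans (q.r_map _)
    refine (𝒢.conj_congr (p.map_mul _ _ hs) rfl (q.map_mul _ _ ht) k₃ k₄
      (x.2.1.trans (𝒢.r_mul _ _ k₁).symm) (x.2.2.trans (𝒢.r_mul _ _ k₂).symm)).trans ?_
    refine (𝒢.conj_mul _ _ _ _ _ k₁ k₂ x.2.1 x.2.2).trans ?_
    exact 𝒢.conj_congr rfl hg rfl _ _ y.2.1 y.2.2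
  mul_assoc x y z h₁ h₂ :=
    Subtype.ext (Prod.ext (𝒮.mul_assoc _ _ _ _ _) (Prod.ext rfl (𝒯.mul_assoc _ _ _ _ _)))
  unit_mul x := Subtype.ext (Prod.ext (𝒮.unit_mul _) (Prod.ext rfl (𝒯.unit_mul _)))
  mul_unit x := Subtype.ext (Prod.ext (𝒮.mul_unit _) (Prod.ext rfl (𝒯.mul_unit _)))
  inv_mul x := Subtype.ext (Prod.ext (𝒮.inv_mul _) (Prod.ext rfl (𝒯.inv_mul _)))
  mul_inv x := Subtype.ext (Prod.ext (𝒮.mul_inv _) (Prod.ext rfl (𝒯.mul_inv _)))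
  continuous_r := by
    refine Continuous.subtype_mk ?_ _
    exact (𝒮.continuous_r.comp (by fun_prop)).prodMk
      (Continuous.prodMk (by fun_prop) (𝒯.continuous_r.comp (by fun_prop)))
  continuous_d := by
    refine Continuous.subtype_mk ?_ _
    exact (𝒮.continuous_d.comp (by fun_prop)).prodMk
      ((continuous_wpbMid p q).prodMk (𝒯.continuous_d.comp (by fun_prop)))
  continuous_unit := by
    refine Continuous.subtype_mk ?_ _
    exact (𝒮.continuous_unit.comp (by fun_prop)).prodMk
      (Continuous.prodMk (by fun_prop) (𝒯.continuous_unit.comp (by fun_prop)))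
  continuous_inv := by
    refine Continuous.subtype_mk ?_ _
    exact (𝒮.continuous_inv.comp (by fun_prop)).prodMk
      ((continuous_wpbMid p q).prodMk (𝒯.continuous_inv.comp (by fun_prop)))
  continuous_mul := by
    refine Continuous.subtype_mk ?_ _
    refine Continuous.prodMk ?_ (Continuous.prodMk (by fun_prop) ?_)
    · refine 𝒮.continuous_mul.comp (Continuous.subtype_mk
        (((continuous_fst.comp continuous_subtype_val).comp
          (continuous_fst.comp continuous_subtype_val)).prodMk
        ((continuous_fst.comp continuous_subtype_val).comp
          (continuous_snd.comp continuous_subtype_val))) ?_)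
      exact fun z => congrArg (fun v => v.1.1) z.2
    · refine 𝒯.continuous_mul.comp (Continuous.subtype_mk
        (((continuous_snd.comp (continuous_snd.comp continuous_subtype_val)).comp
          (continuous_fst.comp continuous_subtype_val)).prodMk
        ((continuous_snd.comp (continuous_snd.comp continuous_subtype_val)).comp
          (continuous_snd.comp continuous_subtype_val))) ?_)
      exact fun z => congrArg (fun v => v.1.2.2) z.2

end WeakPullback

end TopGroupoid

/-! ### Systems of measures -/

/-- A system of measures on `π`: each `κ y` is concentrated on the fibre of `π` over `y`. -/
def IsSystemOfMeasures {X Y : Type*} [MeasurableSpace X] (π : X → Y) (κ : Y → Measure X) : Prop :=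
  ∀ y, κ y (π ⁻¹' {y})ᶜ = 0

/-- Positivity on open sets. -/
def IsPositiveOnOpen {X Y : Type*} [TopologicalSpace X] [MeasurableSpace X] (π : X → Y)
    (κ : Y → Measure X) : Prop :=
  ∀ y, ∀ A : Set X, IsOpen A → (A ∩ π ⁻¹' {y}).Nonempty → 0 < κ y A

/-- Continuity: for every non-negative compactly supported continuous `f`, the function
`y ↦ ∫ f dκ^y` is finite and continuous. -/
def IsContinuousSystem {X Y : Type*} [TopologicalSpace X] [MeasurableSpace X] [TopologicalSpace Y]
    (κ : Y → Measure X) : Prop :=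
  ∀ f : X → ℝ, Continuous f → HasCompactSupport f → (∀ x, 0 ≤ f x) →
    (∀ y, Integrable f (κ y)) ∧ Continuous fun y => ∫ x, f x ∂κ y

/-- Borel systems of measures. -/
def IsBorelSystem {X Y : Type*} [MeasurableSpace X] [MeasurableSpace Y] (κ : Y → Measure X) :
    Prop :=
  ∀ E : Set X, MeasurableSet E → Measurable fun y => κ y E

/-- Locally bounded systems of measures. -/
def IsLocallyBoundedSystem {X Y : Type*} [TopologicalSpace X] [MeasurableSpace X]
    (κ : Y → Measure X) : Prop :=
  ∀ x : X, ∃ U ∈ 𝓝 x, ∃ C : ℝ≥0, 0 < C ∧ ∀ y, κ y U < C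

/-- `γ` is a locally bounded Borel system of measures on `π` that is a disintegration of `μ` with
respect to `ν`. -/
structure IsLocallyBoundedDisintegration {X Y : Type*} [TopologicalSpace X] [MeasurableSpace X]
    [MeasurableSpace Y] (π : X → Y) (γ : Y → Measure X) (μ : Measure X) (ν : Measure Y) :
    Prop where
  system : IsSystemOfMeasures π γ
  borel : IsBorelSystem γ
  locallyBounded : IsLocallyBoundedSystem γ
  disintegration : ∀ E : Set X, MeasurableSet E → μ E = ∫⁻ y, γ y E ∂ν

/-- Equivalence of measures: mutual absolute continuity. -/
def MeasureEquivalent {X : Type*} [MeasurableSpace X] (μ ν : Measure X) : Prop :=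
  μ ≪ ν ∧ ν ≪ μ

/-- The measure `E ↦ ∫ κ^y(E) dν(y)`, for a Borel system of measures `κ`. -/
def integratedMeasure {X Y : Type*} [MeasurableSpace X] [MeasurableSpace Y] (κ : Y → Measure X)
    (ν : Measure Y) : Measure X :=
  ν.bind κ

namespace TopGroupoid

section Haar

variable {G0 G : Type*} [TopologicalSpace G0] [TopologicalSpace G] [MeasurableSpace G0]
  [MeasurableSpace G] (𝒢 : TopGroupoid G0 G)

/-- The set `x · (E ∩ G^{d(x)})`. -/
def leftTranslate (x : G) (E : Set G) : Set G :=
  {z | ∃ y ∈ E, ∃ h : 𝒢.d x = 𝒢.r y, z = 𝒢.mul x y h}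

/-- A continuous left Haar system on a topological groupoid. -/
structure IsHaarSystem (lam : G0 → Measure G) : Prop where
  system : IsSystemOfMeasures 𝒢.r lam
  continuous : IsContinuousSystem lam
  leftInvariant : ∀ x : G, ∀ E : Set G, MeasurableSet E →
    lam (𝒢.d x) E = lam (𝒢.r x) (𝒢.leftTranslate x E)
  positive : IsPositiveOnOpen 𝒢.r lam

/-- The image `μ⁻¹` of a measure under inversion, `μ⁻¹(E) = μ(E⁻¹)`. -/
def invMeasure (μ : Measure G) : Measure G :=
  μ.map 𝒢.inv

/-- Quasi-invariance of a measure `μ0` on the unit space with respect to a system of measures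
`lam` on the range map: the induced measure `∫ lam^u dμ0(u)` is equivalent to its image under
inversion. -/
def QuasiInvariant (lam : G0 → Measure G) (μ0 : Measure G0) : Prop :=
  MeasureEquivalent (integratedMeasure lam μ0) (𝒢.invMeasure (integratedMeasure lam μ0))

/-- `Δ` is a modular function of the measure `μ` on the arrows: a Borel groupoid homomorphism to
the multiplicative group of positive reals that is a Radon-Nikodym derivative `dμ / dμ⁻¹`. -/
structure IsModularFunction (μ : Measure G) (Δ : G → ℝ) : Prop where
  measurable : Measurable Δ
  pos : ∀ x, 0 < Δ x
  map_mul : ∀ x y (h : 𝒢.d x = 𝒢.r y), Δ (𝒢.mul x y h) = Δ x * Δ y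
  density : μ = (𝒢.invMeasure μ).withDensity fun x => ENNReal.ofReal (Δ x)

/-- The measure-theoretic data of a Haar groupoid. On the spaces considered here (second countable,
locally compact, Hausdorff) a Borel measure is Radon if and only if it is locally finite. -/
structure IsHaarGroupoid (lam : G0 → Measure G) (μ0 : Measure G0) : Prop where
  haar : 𝒢.IsHaarSystem lam
  locallyFinite : IsLocallyFiniteMeasure μ0
  ne_zero : μ0 ≠ 0
  quasiInvariant : 𝒢.QuasiInvariant lam μ0

end Haar

section WeakPullbackMeasures

variable {S0 S G0 G T0 T : Type*} [TopologicalSpace S0] [TopologicalSpace S]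
  [TopologicalSpace G0] [TopologicalSpace G] [TopologicalSpace T0] [TopologicalSpace T]
  [MeasurableSpace S0] [MeasurableSpace S] [MeasurableSpace G] [MeasurableSpace T0]
  [MeasurableSpace T]
  {𝒮 : TopGroupoid S0 S} {𝒢 : TopGroupoid G0 G} {𝒯 : TopGroupoid T0 T}

/-- `λ_P^{(s,g,t)} = λ_S^s × δ_g × λ_T^t`, as a measure on `P`. -/
def wpbHaar (p : Hom 𝒮 𝒢) (q : Hom 𝒯 𝒢) (lamS : S0 → Measure S) (lamT : T0 → Measure T)
    (v : WPB0 p q) : Measure (WPB p q) :=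
  ((lamS v.1.1).prod ((Measure.dirac v.1.2.1).prod (lamT v.1.2.2))).comap Subtype.val

/-- `η^x = γ_p^{r(x)} × δ_x × γ_q^{d(x)}`, as a measure on the unit space of `P`. -/
def wpbEta (p : Hom 𝒮 𝒢) (q : Hom 𝒯 𝒢) (γp : G0 → Measure S0) (γq : G0 → Measure T0) (x : G) :
    Measure (WPB0 p q) :=
  ((γp (𝒢.r x)).prod ((Measure.dirac x).prod (γq (𝒢.d x)))).comap Subtype.val

/-- `μ_P^{(0)} = ∫ η^x dμ_G(x)`. -/
def wpbUnitMeasure (p : Hom 𝒮 𝒢) (q : Hom 𝒯 𝒢) (γp : G0 → Measure S0) (γq : G0 → Measure T0)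
    (μG : Measure G) : Measure (WPB0 p q) :=
  integratedMeasure (wpbEta p q γp γq) μG

end WeakPullbackMeasures

end TopGroupoid

end

/-! Write `κ^u = ∫ λ_S^s dγ_p^u(s)` and `θ^u = ∫ λ_T^t dγ_q^u(t)`. These live on the arrows of `S`
and `T` whose image in `G` has range `u`, and the disintegrations give `∫ κ^u dμ_G^{(0)} = μ_S` and
`∫ θ^u dμ_G^{(0)} = μ_T`. Seen in `S × G × T`, the measure `μ_P` is then `M = ∫ κ^{r(x)} × δ_x ×
θ^{d(x)} dμ_G(x)` (`lintegral_wpbMeasure`), and everything reduces to iterated integrals against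
`M`, called `fibredLIntegral`.

Inversion in `P` factors as `L ∘ R`, with `R(s,x,t) = (s, x q(t), t⁻¹)` and `L(s,x,t) = (s⁻¹,
p(s)⁻¹x, t)` (`val_inv_weakPullback`), so it suffices to see how `M` behaves under each factor.

For `L`, split `μ_G` into the measures `λ_G^u`. Over a fixed `u`, Tonelli allows integrating over
`σ` outermost, so `M` becomes `μ_S(dσ) λ_G^{r(p(σ))}(dx) θ^{d(x)}(dτ)` (`fibredLIntegral_bind`).
Left invariance absorbs the translation by `p(σ)⁻¹`, which does not affect `d(x)`, and what remains
is inversion of `σ` under `μ_S`. Hence `L` preserves the null sets of `M`, and `M = Δ_S · L_*M`.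

For `R`, the reflection `(t,x,s) ↦ (s,x⁻¹,t)` exchanges the two sides and turns `R` into the left
inversion for `q`. Reflecting replaces `μ_G` by `μ_G⁻¹`, which keeps null sets and costs a factor
`Δ_G`. The factors before and after differ by the translation by `q(t)`, so `M = (Δ_T / Δ_G ∘ q) ·
R_*M`. Multiplying the two densities gives `Δ_P`.

Tonelli and the composition of kernels need only s-finiteness, which follows from local boundedness
of `γ_p`, `γ_q` and from finiteness of Haar systems on compact sets. -/

open ProbabilityTheory Filter Set

/-! ### Criteria for s-finiteness of kernels -/

namespace ProbabilityTheory.Kernel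

variable {X Y : Type*} [MeasurableSpace X] [MeasurableSpace Y]

/-- A kernel whose values are finite measures is s-finite. -/
theorem isSFiniteKernel_of_measure_univ_lt_top (κ : Kernel Y X) (h : ∀ y, κ y univ < ∞) :
    IsSFiniteKernel κ := by
  classical
  -- `IsFiniteKernel` asks for a bound uniform in `y`. Slicing the base by the integer part `m` of
  -- the total mass gives pieces bounded by `m + 1`.
  have hfl : Measurable fun y => ⌊(κ y univ).toReal⌋₊ :=
    Nat.measurable_floor.comp (κ.measurable_coe MeasurableSet.univ).ennreal_toReal
  have hC : ∀ m : ℕ, MeasurableSet {y | ⌊(κ y univ).toReal⌋₊ = m} := fun m =>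
    hfl (measurableSet_singleton m)
  have hfin : ∀ m, IsFiniteKernel (Kernel.piecewise (hC m) κ 0) := by
    intro m
    refine ⟨⟨ENNReal.ofReal (m + 1), ENNReal.ofReal_lt_top, fun y => ?_⟩⟩
    rw [Kernel.piecewise_apply]
    split_ifs with hy
    · refine (ENNReal.le_ofReal_iff_toReal_le (h y).ne (by positivity)).2 ?_
      have hy' : ⌊(κ y univ).toReal⌋₊ = m := hy
      rw [← hy']
      exact (Nat.lt_floor_add_one _).le
    · simp
  have hsum : κ = Kernel.sum fun m => Kernel.piecewise (hC m) κ 0 := by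
    ext y E hE
    rw [Kernel.sum_apply' _ _ hE, tsum_eq_single ⌊(κ y univ).toReal⌋₊]
    · rw [Kernel.piecewise_apply, if_pos]
      rfl
    · intro m hm
      rw [Kernel.piecewise_apply, if_neg]
      · simp
      · exact fun h' => hm (Eq.symm h')
  rw [hsum]
  infer_instance

/-- A kernel is s-finite if countably many measurable sets, each of finite measure for every value
of the kernel, cover the space. -/
theorem isSFiniteKernel_of_cover (κ : Kernel Y X) {A : ℕ → Set X}
    (hA : ∀ n, MeasurableSet (A n)) (hU : ⋃ n, A n = univ) (h : ∀ n y, κ y (A n) < ∞) :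
    IsSFiniteKernel κ := by
  have hB : ∀ n, MeasurableSet (disjointed A n) := fun n => MeasurableSet.disjointed hA n
  have hfin : ∀ n, IsSFiniteKernel (κ.restrict (hB n)) := fun n =>
    isSFiniteKernel_of_measure_univ_lt_top _ fun y => by
      rw [Kernel.restrict_apply, Measure.restrict_apply_univ]
      exact (measure_mono (disjointed_subset A n)).trans_lt (h n y)
  have hsum : κ = Kernel.sum fun n => κ.restrict (hB n) := by
    ext y E hE
    rw [Kernel.sum_apply' _ _ hE]
    simp_rw [Kernel.restrict_apply, Measure.restrict_apply hE]
    rw [← measure_iUnion, ← inter_iUnion, iUnion_disjointed, hU, inter_univ]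
    · exact fun i j hij => ((disjoint_disjointed A hij).inter_left' E).inter_right' E
    · exact fun n => hE.inter (hB n)
  rw [hsum]
  infer_instance

end ProbabilityTheory.Kernel

/-! ### Locally bounded and continuous systems of measures as s-finite kernels -/

section Systems

variable {X Y : Type*} [MeasurableSpace X]

/-- A Borel system of measures, as a kernel. -/
def IsBorelSystem.kernel [MeasurableSpace Y] {κ : Y → Measure X} (h : IsBorelSystem κ) :
    Kernel Y X :=
  ⟨κ, Measure.measurable_of_measurable_coe κ h⟩

variable [TopologicalSpace X]

/-- By second countability, countably many of the neighbourhoods with bounded mass cover the space;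
their interiors are measurable. -/
theorem IsBorelSystem.isSFiniteKernel_of_isLocallyBoundedSystem [MeasurableSpace Y]
    [OpensMeasurableSpace X] [SecondCountableTopology X] {κ : Y → Measure X}
    (h : IsBorelSystem κ) (hb : IsLocallyBoundedSystem κ) : IsSFiniteKernel h.kernel := by
  choose U hU C _ hC using hb
  obtain ⟨s, hs, hsU⟩ := TopologicalSpace.countable_cover_nhds fun x => interior_mem_nhds.2 (hU x)
  rcases s.eq_empty_or_nonempty with rfl | hne
  · have : IsEmpty X := by
      rw [← Set.univ_eq_empty_iff, ← hsU]; simp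
    exact Kernel.isSFiniteKernel_of_measure_univ_lt_top _ fun y => by
      simp [Set.univ_eq_empty_iff.2 this]
  obtain ⟨e, rfl⟩ := hs.exists_eq_range hne
  refine Kernel.isSFiniteKernel_of_cover _ (A := fun n => interior (U (e n)))
    (fun n => isOpen_interior.measurableSet) ?_ fun n y => ?_
  · rw [← hsU, biUnion_range]
  · exact ((measure_mono interior_subset).trans_lt (hC (e n) y)).trans ENNReal.coe_lt_top

variable [BorelSpace X] [SecondCountableTopology X] [LocallyCompactSpace X] [T2Space X]

/-- A compactly supported continuous function equal to `1` on `K` dominates the indicator of `K` and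
is integrable. -/
theorem IsContinuousSystem.measure_lt_top_of_isCompact [TopologicalSpace Y] {κ : Y → Measure X}
    (h : IsContinuousSystem κ) {K : Set X} (hK : IsCompact K) (y : Y) : κ y K < ∞ := by
  obtain ⟨f, hf1, -, hfc, hf⟩ := exists_continuous_one_zero_of_isCompact hK isClosed_empty
    (disjoint_empty K)
  have hi := (h f f.continuous hfc fun x => (hf x).1).1 y
  refine lt_of_le_of_lt ?_ hi.lintegral_lt_top
  rw [← setLIntegral_one]
  calc ∫⁻ _ in K, 1 ∂κ y ≤ ∫⁻ x in K, ENNReal.ofReal (f x) ∂κ y :=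
        setLIntegral_mono_ae (by fun_prop) (ae_of_all _ fun x hx => by simp [hf1 hx])
    _ ≤ _ := setLIntegral_le_lintegral _ _

/-- A continuous system of measures is a Borel system. -/
theorem IsContinuousSystem.isBorelSystem [TopologicalSpace Y] [MeasurableSpace Y]
    [OpensMeasurableSpace Y] {κ : Y → Measure X} (h : IsContinuousSystem κ) : IsBorelSystem κ := by
  -- The topological hypotheses make `X` metrizable, so indicators of closed sets are limits of
  -- continuous functions.
  let := TopologicalSpace.metrizableSpaceMetric X
  have key : ∀ f : X → ℝ, Continuous f → HasCompactSupport f → (∀ x, 0 ≤ f x) →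
      Measurable fun y => ∫⁻ x, ENNReal.ofReal (f x) ∂κ y := by
    intro f hf hc h0
    obtain ⟨hi, hcont⟩ := h f hf hc h0
    simp_rw [← ofReal_integral_eq_lintegral_ofReal (hi _) (ae_of_all _ h0)]
    exact hcont.measurable.ennreal_ofReal
  -- Weighting by `f` makes all the measures finite, so a π-λ argument starting from closed sets can
  -- pass to complements. Multiplying the approximations of a closed set by `f` keeps the integrands
  -- compactly supported.
  have main : ∀ f : X → ℝ, Continuous f → HasCompactSupport f → (∀ x, 0 ≤ f x) →
      ∀ E, MeasurableSet E →
        Measurable fun y => ((κ y).withDensity fun x => ENNReal.ofReal (f x)) E := by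
    intro f hf hc h0
    have hfm : Measurable fun x => ENNReal.ofReal (f x) := hf.measurable.ennreal_ofReal
    have hfin : ∀ y, IsFiniteMeasure ((κ y).withDensity fun x => ENNReal.ofReal (f x)) := fun y =>
      isFiniteMeasure_withDensity ((h f hf hc h0).1 y).lintegral_lt_top.ne
    have hcl : ∀ F, IsClosed F →
        Measurable fun y => ((κ y).withDensity fun x => ENNReal.ofReal (f x)) F := by
      intro F hF
      refine measurable_of_tendsto_metrizable (f := fun n y =>
        ∫⁻ x, (hF.apprSeq n x : ℝ≥0∞) ∂(κ y).withDensity fun x => ENNReal.ofReal (f x)) ?_ ?_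
      · intro n
        have hg : Continuous fun x => (hF.apprSeq n x : ℝ) := by fun_prop
        have := key (fun x => f x * hF.apprSeq n x) (hf.mul hg) hc.mul_right
          fun x => mul_nonneg (h0 x) (NNReal.coe_nonneg _)
        convert this using 2 with y
        rw [lintegral_withDensity_eq_lintegral_mul _ hfm (by fun_prop)]
        refine lintegral_congr fun x => ?_
        simp [ENNReal.ofReal_mul (h0 x)]
      · rw [tendsto_pi_nhds]
        exact fun y => HasOuterApproxClosed.tendsto_lintegral_apprSeq hF _
    have hgen : ‹MeasurableSpace X› = MeasurableSpace.generateFrom {F | IsClosed F} :=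
      (BorelSpace.measurable_eq (α := X)).trans borel_eq_generateFrom_isClosed
    intro E hE
    induction E, hE using MeasurableSpace.induction_on_inter hgen isPiSystem_isClosed with
    | empty => simp
    | basic F hF => exact hcl F hF
    | compl E hE ih =>
      simp_rw [measure_compl hE (measure_ne_top _ _)]
      exact (hcl univ isClosed_univ).sub ih
    | iUnion E hd hE ih =>
      simp_rw [measure_iUnion hd hE]
      exact Measurable.tsum ih
  intro E hE
  -- The weights are removed by exhausting `X` by compact sets and choosing `f = 1` on each of them.
  let K := CompactExhaustion.choice X
  have hlim : ∀ y, κ y E = ⨆ n, κ y (E ∩ K n) := by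
    intro y
    rw [← Monotone.measure_iUnion, ← inter_iUnion, K.iUnion_eq, inter_univ]
    exact fun i j hij => inter_subset_inter_right _ (K.subset hij)
  simp_rw [hlim]
  refine Measurable.iSup fun n => ?_
  obtain ⟨f, hf1, -, hfc, hf⟩ := exists_continuous_one_zero_of_isCompact (K.isCompact n)
    isClosed_empty (disjoint_empty _)
  have hEK : MeasurableSet (E ∩ K n) := hE.inter (K.isCompact n).measurableSet
  convert main f f.continuous hfc (fun x => (hf x).1) _ hEK using 2 with y
  rw [withDensity_apply _ hEK, ← setLIntegral_one]
  exact setLIntegral_congr_fun hEK fun x hx => by simp [hf1 hx.2]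

theorem IsContinuousSystem.isSFiniteKernel [TopologicalSpace Y] [MeasurableSpace Y]
    {κ : Y → Measure X} (h : IsContinuousSystem κ) (hb : IsBorelSystem κ) :
    IsSFiniteKernel hb.kernel := by
  let K := CompactExhaustion.choice X
  exact Kernel.isSFiniteKernel_of_cover _ (fun n => (K.isCompact n).measurableSet) K.iUnion_eq
    fun n y => h.measure_lt_top_of_isCompact (K.isCompact n) y

end Systems

/-! ### Multiplication as a total map, and left invariance -/

namespace TopGroupoid

section TotalMultiplication

variable {G0 G : Type*} [TopologicalSpace G0] [TopologicalSpace G] (𝒢 : TopGroupoid G0 G)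

/-- Passes the Hausdorff property and second countability from the arrows to the units. -/
theorem isEmbedding_unit : IsEmbedding 𝒢.unit :=
  Function.LeftInverse.isEmbedding 𝒢.r_unit 𝒢.continuous_r 𝒢.continuous_unit

theorem inv_mul_cancel_left (x y : G) (h : 𝒢.d x = 𝒢.r y) :
    𝒢.mul (𝒢.inv x) (𝒢.mul x y h) ((𝒢.d_inv x).trans (𝒢.r_mul x y h).symm) = y := by
  rw [← 𝒢.mul_assoc (𝒢.inv x) x y (𝒢.d_inv x) h,
    𝒢.mul_congr (𝒢.inv_mul x) rfl _ ((𝒢.d_unit _).trans h), 𝒢.unit_mul']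

theorem mul_inv_cancel_left (x y : G) (h : 𝒢.r y = 𝒢.r x) :
    𝒢.mul x (𝒢.mul (𝒢.inv x) y ((𝒢.d_inv x).trans h.symm))
      ((𝒢.r_inv x).symm.trans (𝒢.r_mul _ _ _).symm) = y := by
  rw [← 𝒢.mul_assoc x (𝒢.inv x) y (𝒢.r_inv x).symm ((𝒢.d_inv x).trans h.symm),
    𝒢.mul_congr (𝒢.mul_inv x) rfl _ ((𝒢.d_unit _).trans h.symm), 𝒢.unit_mul']

open Classical in
/-- The product of two arrows, extended to all pairs by `(x, y) ↦ y`. -/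
noncomputable def mulTotal (x y : G) : G :=
  if h : 𝒢.d x = 𝒢.r y then 𝒢.mul x y h else y

theorem mulTotal_eq_mul {x y : G} (h : 𝒢.d x = 𝒢.r y) : 𝒢.mulTotal x y = 𝒢.mul x y h :=
  dif_pos h

/-- The default value `y` is chosen for this: translation on the left never changes `d`, hence never
moves a kernel based at `d x`. -/
theorem d_mulTotal (x y : G) : 𝒢.d (𝒢.mulTotal x y) = 𝒢.d y := by
  unfold mulTotal
  split_ifs with h
  · exact 𝒢.d_mul x y h
  · rfl

variable [MeasurableSpace G] [BorelSpace G] [SecondCountableTopology G]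

theorem measurable_mulTotal [T2Space G0] :
    Measurable fun z : G × G => 𝒢.mulTotal z.1 z.2 := by
  classical
  have hs : MeasurableSet {z : G × G | 𝒢.d z.1 = 𝒢.r z.2} :=
    (isClosed_eq (𝒢.continuous_d.comp continuous_fst)
      (𝒢.continuous_r.comp continuous_snd)).measurableSet
  exact Measurable.dite (s := {z : G × G | 𝒢.d z.1 = 𝒢.r z.2})
    (f := fun z => 𝒢.mul z.1.1 z.1.2 z.2) (g := fun z => z.1.2)
    𝒢.continuous_mul.measurable (by fun_prop) hs

/-- Left invariance of a Haar system as an equality of measures. -/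
theorem IsHaarSystem.map_mulTotal_inv {𝒢 : TopGroupoid G0 G} [T2Space G0] [MeasurableSpace G0]
    {lam : G0 → Measure G} (h : 𝒢.IsHaarSystem lam) (a : G) :
    (lam (𝒢.r a)).map (𝒢.mulTotal (𝒢.inv a)) = lam (𝒢.d a) := by
  have hm : Measurable (𝒢.mulTotal (𝒢.inv a)) :=
    𝒢.measurable_mulTotal.comp (measurable_const.prodMk measurable_id)
  ext E hE
  rw [Measure.map_apply hm hE, h.leftInvariant a E hE]
  -- The preimage of `E` and the translate of `E` may differ where the product is undefined, but
  -- only off the fibre over `r a`, which is null.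
  refine measure_congr ?_
  have hr : ∀ᵐ z ∂lam (𝒢.r a), 𝒢.r z = 𝒢.r a := h.system (𝒢.r a)
  filter_upwards [hr] with z hz
  refine propext ⟨fun (hzE : 𝒢.mulTotal (𝒢.inv a) z ∈ E) => ?_, ?_⟩
  · rw [𝒢.mulTotal_eq_mul ((𝒢.d_inv a).trans hz.symm)] at hzE
    exact ⟨_, hzE, (𝒢.r_inv a).symm.trans (𝒢.r_mul _ _ _).symm,
      (𝒢.mul_inv_cancel_left a z hz).symm⟩
  · rintro ⟨y, hy, hay, rfl⟩
    change 𝒢.mulTotal (𝒢.inv a) _ ∈ E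
    rwa [𝒢.mulTotal_eq_mul ((𝒢.d_inv a).trans (𝒢.r_mul _ _ _).symm), 𝒢.inv_mul_cancel_left]

end TotalMultiplication

end TopGroupoid

/-! ### Fibred integrals over `S × G × T` -/

/-- Integration against a kernel with a measurably varying base point is measurable. -/
theorem Measurable.lintegral_kernel_comp {A B C : Type*} [MeasurableSpace A] [MeasurableSpace B]
    [MeasurableSpace C] (κ : Kernel B C) [IsSFiniteKernel κ] {g : A → B} (hg : Measurable g)
    {F : A → C → ℝ≥0∞} (hF : Measurable (Function.uncurry F)) :
    Measurable fun a => ∫⁻ c, F a c ∂κ (g a) :=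
  Measurable.lintegral_kernel_prod_right (κ := κ.comap g hg) hF

namespace TopGroupoid

section Reflection

variable {S G0 G T : Type*} [TopologicalSpace G0] [TopologicalSpace G]

/-- The reflection `(t, x, s) ↦ (s, x⁻¹, t)`. -/
def reflect (𝒢 : TopGroupoid G0 G) (z : T × G × S) : S × G × T :=
  (z.2.2, 𝒢.inv z.2.1, z.1)

theorem measurable_reflect [MeasurableSpace S] [MeasurableSpace T] [MeasurableSpace G]
    [BorelSpace G] (𝒢 : TopGroupoid G0 G) :
    Measurable (𝒢.reflect (S := S) (T := T)) := by
  have := 𝒢.continuous_inv.measurable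
  unfold reflect
  fun_prop

end Reflection

section FibredIntegral

variable {S G0 G T : Type*} [TopologicalSpace G0] [TopologicalSpace G]
  [MeasurableSpace S] [MeasurableSpace G0] [MeasurableSpace G] [MeasurableSpace T]
  (𝒢 : TopGroupoid G0 G)

/-- The integral of `F` against `∫ κ^{r(x)} × δ_x × θ^{d(x)} dμ(x)`. -/
noncomputable def fibredLIntegral (μ : Measure G) (κ : Kernel G0 S) (θ : Kernel G0 T) (F : S × G × T → ℝ≥0∞) :
    ℝ≥0∞ :=
  ∫⁻ x, ∫⁻ σ, ∫⁻ τ, F (σ, x, τ) ∂θ (𝒢.d x) ∂κ (𝒢.r x) ∂μ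

variable {𝒢} {μ ν : Measure G} {κ : Kernel G0 S} {θ : Kernel G0 T} {F F' : S × G × T → ℝ≥0∞}

/-- The fibred measure sees only triples whose endpoints match, so identities involving partial
products need checking only there. -/
theorem fibredLIntegral_congr {a : S → G0} {b : T → G0} (hκ : ∀ u, ∀ᵐ σ ∂κ u, a σ = u)
    (hθ : ∀ u, ∀ᵐ τ ∂θ u, b τ = u)
    (h : ∀ z : S × G × T, 𝒢.r z.2.1 = a z.1 → 𝒢.d z.2.1 = b z.2.2 → F z = F' z) :
    𝒢.fibredLIntegral μ κ θ F = 𝒢.fibredLIntegral μ κ θ F' := by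
  refine lintegral_congr fun x => lintegral_congr_ae ?_
  filter_upwards [hκ (𝒢.r x)] with σ hσ
  refine lintegral_congr_ae ?_
  filter_upwards [hθ (𝒢.d x)] with τ hτ
  exact h (σ, x, τ) hσ.symm hτ.symm

variable [BorelSpace G0] [BorelSpace G] [IsSFiniteKernel κ] [IsSFiniteKernel θ]

theorem measurable_fibredLIntegral_inner (hF : Measurable F) :
    Measurable fun x => ∫⁻ σ, ∫⁻ τ, F (σ, x, τ) ∂θ (𝒢.d x) ∂κ (𝒢.r x) := by
  have hr := 𝒢.continuous_r.measurable
  have hd := 𝒢.continuous_d.measurable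
  refine Measurable.lintegral_kernel_comp κ hr
    (F := fun x σ => ∫⁻ τ, F (σ, x, τ) ∂θ (𝒢.d x)) ?_
  exact Measurable.lintegral_kernel_comp θ (A := G × S) (g := fun z => 𝒢.d z.1)
    (hd.comp measurable_fst) (F := fun z τ => F (z.2, z.1, τ))
    (hF.comp (by fun_prop : Measurable fun w : (G × S) × T => (w.1.2, w.1.1, w.2)))

theorem fibredLIntegral_eq_zero_of_absolutelyContinuous (hF : Measurable F) (h : μ ≪ ν)
    (h0 : 𝒢.fibredLIntegral ν κ θ F = 0) : 𝒢.fibredLIntegral μ κ θ F = 0 := by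
  rw [fibredLIntegral, lintegral_eq_zero_iff (measurable_fibredLIntegral_inner hF)] at h0 ⊢
  exact h.ae_le h0

theorem fibredLIntegral_withDensity (hF : Measurable F) {D : G → ℝ≥0∞} (hD : Measurable D) :
    𝒢.fibredLIntegral (μ.withDensity D) κ θ F =
      𝒢.fibredLIntegral μ κ θ fun z => D z.2.1 * F z := by
  rw [fibredLIntegral, lintegral_withDensity_eq_lintegral_mul _ hD
    (measurable_fibredLIntegral_inner hF)]
  refine lintegral_congr fun x => ?_
  have hd : Measurable fun σ : S => ∫⁻ τ, F (σ, x, τ) ∂θ (𝒢.d x) :=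
    Measurable.lintegral_kernel_comp θ (g := fun _ : S => 𝒢.d x) measurable_const
      (F := fun σ τ => F (σ, x, τ))
      (hF.comp (by fun_prop : Measurable fun w : S × T => (w.1, x, w.2)))
  rw [Pi.mul_apply, ← lintegral_const_mul _ hd]
  refine lintegral_congr fun σ => ?_
  have hτ : Measurable fun τ : T => F (σ, x, τ) :=
    hF.comp (by fun_prop : Measurable fun τ : T => (σ, x, τ))
  exact (lintegral_const_mul _ hτ).symm

/-- Inversion of `x` exchanges `r` and `d`, so the two kernels trade places; Tonelli restores the
order of integration. -/
theorem fibredLIntegral_invMeasure (hF : Measurable F) :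
    𝒢.fibredLIntegral (𝒢.invMeasure μ) κ θ F =
      𝒢.fibredLIntegral μ θ κ (F ∘ 𝒢.reflect) := by
  rw [fibredLIntegral, invMeasure, lintegral_map (measurable_fibredLIntegral_inner hF)
    𝒢.continuous_inv.measurable]
  refine lintegral_congr fun x => ?_
  rw [𝒢.r_inv, 𝒢.d_inv, lintegral_lintegral_swap]
  · rfl
  · exact (hF.comp (by fun_prop : Measurable fun w : S × T => (w.1, 𝒢.inv x, w.2))).aemeasurable

/-- A measure induced by a system on the range map can be integrated fibrewise over the
left-hand factor first. -/
theorem fibredLIntegral_bind {Λ : Kernel G0 G} [IsSFiniteKernel Λ] {μ0 : Measure G0} {a : S → G0}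
    (ha : Measurable a) (hΛ : ∀ u, ∀ᵐ x ∂Λ u, 𝒢.r x = u) (hκ : ∀ u, ∀ᵐ σ ∂κ u, a σ = u)
    (hF : Measurable F) :
    𝒢.fibredLIntegral (μ0.bind Λ) κ θ F =
      ∫⁻ σ, ∫⁻ x, ∫⁻ τ, F (σ, x, τ) ∂θ (𝒢.d x) ∂Λ (a σ) ∂μ0.bind κ := by
  have hd := 𝒢.continuous_d.measurable
  have hH : Measurable fun z : S × G => ∫⁻ τ, F (z.1, z.2, τ) ∂θ (𝒢.d z.2) :=
    Measurable.lintegral_kernel_comp θ (g := fun z : S × G => 𝒢.d z.2)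
      (hd.comp measurable_snd) (F := fun z τ => F (z.1, z.2, τ))
      (hF.comp (by fun_prop : Measurable fun w : (S × G) × T => (w.1.1, w.1.2, w.2)))
  have hI : Measurable fun σ => ∫⁻ x, ∫⁻ τ, F (σ, x, τ) ∂θ (𝒢.d x) ∂Λ (a σ) :=
    Measurable.lintegral_kernel_comp Λ ha
      (F := fun σ x => ∫⁻ τ, F (σ, x, τ) ∂θ (𝒢.d x)) hH
  rw [fibredLIntegral, Measure.lintegral_bind Λ.measurable.aemeasurable
      (measurable_fibredLIntegral_inner hF).aemeasurable,
    Measure.lintegral_bind κ.measurable.aemeasurable hI.aemeasurable]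
  refine lintegral_congr fun u => ?_
  -- Under `Λ u` the kernel `κ (r x)` is the constant `κ u`, which makes Tonelli applicable;
  -- afterwards `u` is read off from `σ` as `a σ`.
  calc ∫⁻ x, ∫⁻ σ, ∫⁻ τ, F (σ, x, τ) ∂θ (𝒢.d x) ∂κ (𝒢.r x) ∂Λ u
      = ∫⁻ x, ∫⁻ σ, ∫⁻ τ, F (σ, x, τ) ∂θ (𝒢.d x) ∂κ u ∂Λ u := by
        refine lintegral_congr_ae ?_
        filter_upwards [hΛ u] with x hx
        rw [hx]
    _ = ∫⁻ σ, ∫⁻ x, ∫⁻ τ, F (σ, x, τ) ∂θ (𝒢.d x) ∂Λ u ∂κ u :=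
        lintegral_lintegral_swap (hH.comp measurable_swap).aemeasurable
    _ = ∫⁻ σ, ∫⁻ x, ∫⁻ τ, F (σ, x, τ) ∂θ (𝒢.d x) ∂Λ (a σ) ∂κ u := by
        refine lintegral_congr_ae ?_
        filter_upwards [hκ u] with σ hσ
        rw [hσ]

end FibredIntegral

/-! ### Left inversion and the factor `S` -/

section Translation

variable {S0 S G0 G T : Type*} [TopologicalSpace S0] [TopologicalSpace S]
  [TopologicalSpace G0] [TopologicalSpace G]
  [MeasurableSpace S] [MeasurableSpace G] [MeasurableSpace T]
  {𝒮 : TopGroupoid S0 S} {𝒢 : TopGroupoid G0 G}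

/-- `(s, x, t) ↦ (s⁻¹, p(s)⁻¹ x, t)`. -/
noncomputable def leftInversion (p : Hom 𝒮 𝒢) (z : S × G × T) : S × G × T :=
  (𝒮.inv z.1, 𝒢.mulTotal (𝒢.inv (p.map z.1)) z.2.1, z.2.2)

variable [BorelSpace S] [BorelSpace G]

theorem measurable_leftInversion [SecondCountableTopology G] [T2Space G0] (p : Hom 𝒮 𝒢) :
    Measurable (leftInversion (T := T) p) := by
  have h1 := 𝒮.continuous_inv.measurable
  have h2 := 𝒢.continuous_inv.measurable
  have h3 := p.continuous_map.measurable
  have h4 : Measurable fun z : S × G × T => 𝒢.mulTotal (𝒢.inv (p.map z.1)) z.2.1 :=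
    𝒢.measurable_mulTotal.comp
      (by fun_prop : Measurable fun z : S × G × T => (𝒢.inv (p.map z.1), z.2.1))
  unfold leftInversion
  fun_prop

variable [MeasurableSpace G0] [BorelSpace G0] {κ : Kernel G0 S} [IsSFiniteKernel κ] {θ : Kernel G0 T}
  [IsSFiniteKernel θ] {Λ : Kernel G0 G} [IsSFiniteKernel Λ] {μ0 : Measure G0}
  {F : S × G × T → ℝ≥0∞}

theorem measurable_lintegral_left (p : Hom 𝒮 𝒢) (hF : Measurable F) :
    Measurable fun σ => ∫⁻ x, ∫⁻ τ, F (σ, x, τ) ∂θ (𝒢.d x) ∂Λ (𝒢.r (p.map σ)) := by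
  have hd := 𝒢.continuous_d.measurable
  refine Measurable.lintegral_kernel_comp Λ
    (𝒢.continuous_r.comp p.continuous_map).measurable
    (F := fun σ x => ∫⁻ τ, F (σ, x, τ) ∂θ (𝒢.d x)) ?_
  exact Measurable.lintegral_kernel_comp θ (g := fun z : S × G => 𝒢.d z.2)
    (hd.comp measurable_snd) (F := fun z τ => F (z.1, z.2, τ))
    (hF.comp (by fun_prop : Measurable fun w : (S × G) × T => (w.1.1, w.1.2, w.2)))

variable [SecondCountableTopology G] [T2Space G0]

/-- For fixed `σ`, left invariance carries `λ^{r(p(σ))}` to `λ^{d(p(σ))}`, and `d(p(σ)) =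
r(p(σ⁻¹))`: the base point is already the one belonging to `σ⁻¹`. -/
theorem lintegral_comp_leftInversion (p : Hom 𝒮 𝒢)
    (hinv : ∀ a, (Λ (𝒢.r a)).map (𝒢.mulTotal (𝒢.inv a)) = Λ (𝒢.d a)) (ν : Measure S)
    (hF : Measurable F) :
    ∫⁻ σ, ∫⁻ x, ∫⁻ τ, F (leftInversion p (σ, x, τ)) ∂θ (𝒢.d x) ∂Λ (𝒢.r (p.map σ)) ∂ν =
      ∫⁻ σ, ∫⁻ x, ∫⁻ τ, F (σ, x, τ) ∂θ (𝒢.d x) ∂Λ (𝒢.r (p.map σ)) ∂𝒮.invMeasure ν := by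
  have hd := 𝒢.continuous_d.measurable
  rw [invMeasure, lintegral_map (measurable_lintegral_left p hF) 𝒮.continuous_inv.measurable]
  refine lintegral_congr fun σ => ?_
  have hm : Measurable (𝒢.mulTotal (𝒢.inv (p.map σ))) :=
    𝒢.measurable_mulTotal.comp (measurable_const.prodMk measurable_id)
  have hH : Measurable fun x : G => ∫⁻ τ, F (𝒮.inv σ, x, τ) ∂θ (𝒢.d x) :=
    Measurable.lintegral_kernel_comp θ hd (F := fun x τ => F (𝒮.inv σ, x, τ))
      (hF.comp (by fun_prop : Measurable fun w : G × T => (𝒮.inv σ, w.1, w.2)))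
  have e : 𝒢.r (p.map (𝒮.inv σ)) = 𝒢.d (p.map σ) := by rw [p.r_map, 𝒮.r_inv, p.d_map]
  rw [e, ← hinv, lintegral_map hH hm]
  refine lintegral_congr fun x => ?_
  rw [𝒢.d_mulTotal]
  rfl

variable (p : Hom 𝒮 𝒢) (hΛ : ∀ u, ∀ᵐ x ∂Λ u, 𝒢.r x = u)
  (hκ : ∀ u, ∀ᵐ σ ∂κ u, 𝒢.r (p.map σ) = u)
  (hinv : ∀ a, (Λ (𝒢.r a)).map (𝒢.mulTotal (𝒢.inv a)) = Λ (𝒢.d a))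

include hΛ hκ hinv

/-- With `σ` outermost, composing with `leftInversion` only replaces `μ_S` by `μ_S⁻¹`, which has the
same null sets. -/
theorem fibredLIntegral_comp_leftInversion_eq_zero_iff
    (hq : MeasureEquivalent (μ0.bind κ) (𝒮.invMeasure (μ0.bind κ))) (hF : Measurable F) :
    𝒢.fibredLIntegral (μ0.bind Λ) κ θ (F ∘ leftInversion p) = 0 ↔
      𝒢.fibredLIntegral (μ0.bind Λ) κ θ F = 0 := by
  have ha := (𝒢.continuous_r.comp p.continuous_map).measurable
  rw [fibredLIntegral_bind ha hΛ hκ hF,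
    fibredLIntegral_bind ha hΛ hκ (hF.comp (measurable_leftInversion p))]
  have e := lintegral_comp_leftInversion (θ := θ) p hinv (μ0.bind κ) hF
  simp only [Function.comp_apply]
  rw [e, lintegral_eq_zero_iff (measurable_lintegral_left p hF),
    lintegral_eq_zero_iff (measurable_lintegral_left p hF)]
  exact ⟨fun h => hq.1.ae_le h, fun h => hq.2.ae_le h⟩

theorem fibredLIntegral_eq_comp_leftInversion {D : S → ℝ≥0∞} (hD : Measurable D)
    (hden : μ0.bind κ = (𝒮.invMeasure (μ0.bind κ)).withDensity D) (hF : Measurable F) :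
    𝒢.fibredLIntegral (μ0.bind Λ) κ θ F =
      𝒢.fibredLIntegral (μ0.bind Λ) κ θ ((fun z => D z.1 * F z) ∘ leftInversion p) := by
  have ha := (𝒢.continuous_r.comp p.continuous_map).measurable
  have hDF : Measurable fun z : S × G × T => D z.1 * F z := (hD.comp measurable_fst).mul hF
  rw [fibredLIntegral_bind ha hΛ hκ hF,
    fibredLIntegral_bind ha hΛ hκ (hDF.comp (measurable_leftInversion p))]
  simp only [Function.comp_apply]
  rw [lintegral_comp_leftInversion (F := fun z => D z.1 * F z) (θ := θ) p hinv (μ0.bind κ) hDF]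
  conv_lhs => rw [hden]
  rw [lintegral_withDensity_eq_lintegral_mul _ hD (measurable_lintegral_left p hF)]
  refine lintegral_congr fun σ => ?_
  have hd := 𝒢.continuous_d.measurable
  have hH : Measurable fun x : G => ∫⁻ τ, F (σ, x, τ) ∂θ (𝒢.d x) :=
    Measurable.lintegral_kernel_comp θ hd (F := fun x τ => F (σ, x, τ))
      (hF.comp (by fun_prop : Measurable fun w : G × T => (σ, w.1, w.2)))
  rw [Pi.mul_apply, ← lintegral_const_mul _ hH]
  refine lintegral_congr fun x => ?_
  have hτ : Measurable fun τ : T => F (σ, x, τ) :=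
    hF.comp (by fun_prop : Measurable fun τ : T => (σ, x, τ))
  exact (lintegral_const_mul _ hτ).symm

end Translation

end TopGroupoid

/-! ### Modular functions, right inversion and the factor `T` -/

namespace TopGroupoid

section Modular

variable {G0 G : Type*} [TopologicalSpace G0] [TopologicalSpace G] [MeasurableSpace G]
  {𝒢 : TopGroupoid G0 G} {μ : Measure G} {Δ : G → ℝ}

theorem IsModularFunction.map_unit (h : 𝒢.IsModularFunction μ Δ) (u : G0) :
    Δ (𝒢.unit u) = 1 := by
  have e := h.map_mul (𝒢.unit u) (𝒢.unit u) ((𝒢.d_unit u).trans (𝒢.r_unit u).symm)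
  rw [𝒢.unit_mul'] at e
  exact mul_left_cancel₀ (h.pos (𝒢.unit u)).ne' (e.symm.trans (mul_one _).symm)

theorem IsModularFunction.map_inv (h : 𝒢.IsModularFunction μ Δ) (x : G) :
    Δ (𝒢.inv x) = (Δ x)⁻¹ := by
  have e := h.map_mul (𝒢.inv x) x (𝒢.d_inv x)
  rw [𝒢.inv_mul, h.map_unit] at e
  exact eq_inv_of_mul_eq_one_left e.symm

end Modular

section RightInversion

variable {S T0 T G0 G : Type*} [TopologicalSpace T0] [TopologicalSpace T]
  [TopologicalSpace G0] [TopologicalSpace G] {𝒯 : TopGroupoid T0 T} {𝒢 : TopGroupoid G0 G}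

/-- `(s, x, t) ↦ (s, x q(t), t⁻¹)`. -/
noncomputable def rightInversion (q : Hom 𝒯 𝒢) (z : S × G × T) : S × G × T :=
  (z.1, 𝒢.inv (𝒢.mulTotal (𝒢.inv (q.map z.2.2)) (𝒢.inv z.2.1)), 𝒯.inv z.2.2)

/-- Writing `x q(t)` as `(q(t)⁻¹ x⁻¹)⁻¹` makes this hold for all triples, composable or not. -/
theorem rightInversion_reflect (q : Hom 𝒯 𝒢) (z : T × G × S) :
    rightInversion q (𝒢.reflect z) = 𝒢.reflect (leftInversion q z) := by
  simp only [rightInversion, reflect, leftInversion, 𝒢.inv_inv]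

variable [MeasurableSpace S] [MeasurableSpace G] [MeasurableSpace T]
  [BorelSpace T] [BorelSpace G] [SecondCountableTopology G] [T2Space G0]

theorem measurable_rightInversion (q : Hom 𝒯 𝒢) :
    Measurable (rightInversion (S := S) q) := by
  have h1 := 𝒯.continuous_inv.measurable
  have h2 := 𝒢.continuous_inv.measurable
  have h3 := q.continuous_map.measurable
  have h4 : Measurable fun z : S × G × T =>
      𝒢.mulTotal (𝒢.inv (q.map z.2.2)) (𝒢.inv z.2.1) :=
    𝒢.measurable_mulTotal.comp
      (by fun_prop : Measurable fun z : S × G × T => (𝒢.inv (q.map z.2.2), 𝒢.inv z.2.1))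
  unfold rightInversion
  fun_prop

variable [MeasurableSpace G0] [BorelSpace G0] {κ : Kernel G0 S} [IsSFiniteKernel κ]
  {θ : Kernel G0 T} [IsSFiniteKernel θ] {Λ : Kernel G0 G} [IsSFiniteKernel Λ] {μ0 : Measure G0}
  {F : S × G × T → ℝ≥0∞}

theorem fibredLIntegral_comp_rightInversion_eq_zero_iff (q : Hom 𝒯 𝒢)
    (hΛ : ∀ u, ∀ᵐ x ∂Λ u, 𝒢.r x = u) (hθ : ∀ u, ∀ᵐ τ ∂θ u, 𝒢.r (q.map τ) = u)
    (hinv : ∀ a, (Λ (𝒢.r a)).map (𝒢.mulTotal (𝒢.inv a)) = Λ (𝒢.d a))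
    (hT : MeasureEquivalent (μ0.bind θ) (𝒯.invMeasure (μ0.bind θ)))
    (hG : MeasureEquivalent (μ0.bind Λ) (𝒢.invMeasure (μ0.bind Λ))) (hF : Measurable F) :
    𝒢.fibredLIntegral (μ0.bind Λ) κ θ (F ∘ rightInversion q) = 0 ↔
      𝒢.fibredLIntegral (μ0.bind Λ) κ θ F = 0 := by
  have base : ∀ F : S × G × T → ℝ≥0∞, Measurable F →
      (𝒢.fibredLIntegral (μ0.bind Λ) κ θ F = 0 ↔
        𝒢.fibredLIntegral (μ0.bind Λ) θ κ (F ∘ 𝒢.reflect) = 0) := by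
    intro F hF
    rw [← fibredLIntegral_invMeasure hF]
    exact ⟨fibredLIntegral_eq_zero_of_absolutelyContinuous hF hG.2,
      fibredLIntegral_eq_zero_of_absolutelyContinuous hF hG.1⟩
  have e : (F ∘ rightInversion q) ∘ 𝒢.reflect = (F ∘ 𝒢.reflect) ∘ leftInversion q :=
    funext fun z => congrArg F (rightInversion_reflect q z)
  rw [base _ (hF.comp (measurable_rightInversion q)), base _ hF, e]
  exact fibredLIntegral_comp_leftInversion_eq_zero_iff q hΛ hθ hinv hT
    (hF.comp 𝒢.measurable_reflect)

/-- Reflect, apply the left inversion for `q`, reflect back. The factors `Δ_G` from the two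
reflections are taken at points differing by a translation by `q(t)`, so only `Δ_G(q(t))` survives.
-/
theorem fibredLIntegral_eq_comp_rightInversion (q : Hom 𝒯 𝒢) {a : S → G0}
    (hΛ : ∀ u, ∀ᵐ x ∂Λ u, 𝒢.r x = u) (hκ : ∀ u, ∀ᵐ σ ∂κ u, a σ = u)
    (hθ : ∀ u, ∀ᵐ τ ∂θ u, 𝒢.r (q.map τ) = u)
    (hinv : ∀ a, (Λ (𝒢.r a)).map (𝒢.mulTotal (𝒢.inv a)) = Λ (𝒢.d a))
    {ΔT : T → ℝ} {ΔG : G → ℝ} (hT : 𝒯.IsModularFunction (μ0.bind θ) ΔT)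
    (hG : 𝒢.IsModularFunction (μ0.bind Λ) ΔG) (hF : Measurable F) :
    𝒢.fibredLIntegral (μ0.bind Λ) κ θ F = 𝒢.fibredLIntegral (μ0.bind Λ) κ θ
      ((fun z => ENNReal.ofReal (ΔT z.2.2 / ΔG (q.map z.2.2)) * F z) ∘ rightInversion q) := by
  have hDT : Measurable fun t => ENNReal.ofReal (ΔT t) := hT.measurable.ennreal_ofReal
  have hDG : Measurable fun x => ENNReal.ofReal (ΔG x) := hG.measurable.ennreal_ofReal
  have hDq : Measurable fun t => ENNReal.ofReal (ΔT t / ΔG (q.map t)) :=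
    (hT.measurable.div (hG.measurable.comp q.continuous_map.measurable)).ennreal_ofReal
  have hR := measurable_rightInversion (S := S) q
  have base : ∀ F : S × G × T → ℝ≥0∞, Measurable F →
      𝒢.fibredLIntegral (μ0.bind Λ) κ θ F = 𝒢.fibredLIntegral (μ0.bind Λ) θ κ
        ((fun z => ENNReal.ofReal (ΔG z.2.1) * F z) ∘ 𝒢.reflect) := by
    intro F hF
    conv_lhs => rw [hG.density]
    have hm : Measurable fun z : S × G × T => ENNReal.ofReal (ΔG z.2.1) * F z :=
      (hDG.comp (by fun_prop : Measurable fun z : S × G × T => z.2.1)).mul hF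
    rw [fibredLIntegral_withDensity hF hDG, fibredLIntegral_invMeasure hm]
  have hF1 : Measurable fun z : S × G × T => ENNReal.ofReal (ΔG z.2.1) * F z :=
    (hDG.comp (by fun_prop : Measurable fun z : S × G × T => z.2.1)).mul hF
  have hF2 : Measurable fun z : S × G × T =>
      ENNReal.ofReal (ΔT z.2.2 / ΔG (q.map z.2.2)) * F z :=
    (hDq.comp (by fun_prop : Measurable fun z : S × G × T => z.2.2)).mul hF
  rw [base F hF, fibredLIntegral_eq_comp_leftInversion q hΛ hθ hinv hDT hT.density
    (hF1.comp 𝒢.measurable_reflect), base _ (hF2.comp hR)]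
  -- Multiplicativity of `Δ_G` needs `q(t)⁻¹` and `x` composable, hence the restriction to matching
  -- triples.
  refine fibredLIntegral_congr hθ hκ fun z hz _ => ?_
  simp only [Function.comp_apply, rightInversion_reflect]
  have hd : 𝒢.d (𝒢.inv (q.map z.1)) = 𝒢.r z.2.1 := (𝒢.d_inv _).trans hz.symm
  simp only [reflect, leftInversion, 𝒢.mulTotal_eq_mul hd, hG.map_inv, hG.map_mul]
  rw [← _root_.mul_assoc, ← _root_.mul_assoc, ← ENNReal.ofReal_mul (hT.pos _).le,
    ← ENNReal.ofReal_mul (inv_nonneg.2 (hG.pos _).le)]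
  congr 2
  have e : ΔG (q.map (𝒯.inv z.1)) = (ΔG (q.map z.1))⁻¹ := by
    have hc : 𝒯.d (𝒯.inv z.1) = 𝒯.r z.1 := 𝒯.d_inv _
    have h1 := congrArg ΔG (q.map_mul (𝒯.inv z.1) z.1 hc)
    rw [𝒯.inv_mul, q.map_unit, hG.map_unit, hG.map_mul] at h1
    exact eq_inv_of_mul_eq_one_left h1.symm
  rw [e]
  have := (hG.pos z.2.1).ne'
  have := (hG.pos (q.map z.1)).ne'
  field_simp

end RightInversion

end TopGroupoid

/-! ### The measure on the weak pullback as a fibred integral -/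

theorem MeasureTheory.lintegral_comap_subtype_val_of_ae {A : Type*} [MeasurableSpace A]
    {M : Measure A} {P : A → Prop} (hs : MeasurableSet {a | P a}) (h : ∀ᵐ a ∂M, P a)
    (F : A → ℝ≥0∞) :
    ∫⁻ z : {a // P a}, F z.1 ∂M.comap Subtype.val = ∫⁻ a, F a ∂M := by
  have := lintegral_subtype_comap (μ := M) hs F
  rw [Measure.restrict_eq_self_of_ae_mem (s := {a | P a}) h] at this
  exact this

section DiracProduct

variable {A X B : Type*} [MeasurableSpace A] [MeasurableSpace X] [MeasurableSpace B]
  (α : Measure A) (β : Measure B) (x : X)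

theorem MeasureTheory.lintegral_prod_dirac_prod [SFinite β] {F : A × X × B → ℝ≥0∞}
    (hF : Measurable F) :
    ∫⁻ z, F z ∂α.prod ((Measure.dirac x).prod β) = ∫⁻ a, ∫⁻ b, F (a, x, b) ∂β ∂α := by
  rw [lintegral_prod _ hF.aemeasurable]
  refine lintegral_congr fun a => ?_
  have ha : Measurable fun w : X × B => F (a, w) := hF.comp measurable_prodMk_left
  rw [lintegral_prod _ ha.aemeasurable, lintegral_dirac' x ha.lintegral_prod_right']

/-- Shows that the product measures defining `η^x` and `λ_P^v` are concentrated on the matching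
triples, so restricting them to the subtype loses no mass. -/
theorem MeasureTheory.ae_prod_dirac_prod [MeasurableSingletonClass X] {Y Z : Type*} {f : A → Y}
    {g : B → Z} {r : X → Y} {d : X → Z} (hf : ∀ᵐ a ∂α, f a = r x) (hg : ∀ᵐ b ∂β, g b = d x) :
    ∀ᵐ z ∂α.prod ((Measure.dirac x).prod β), r z.2.1 = f z.1 ∧ d z.2.1 = g z.2.2 := by
  have hx : ∀ᵐ y ∂Measure.dirac x, y = x := by
    rw [ae_dirac_eq]
    exact Filter.eventually_pure.2 rfl
  have q1 := (Measure.quasiMeasurePreserving_fst (μ := α)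
    (ν := (Measure.dirac x).prod β)).ae hf
  have q := Measure.quasiMeasurePreserving_snd (μ := α) (ν := (Measure.dirac x).prod β)
  have q2 := q.ae ((Measure.quasiMeasurePreserving_fst (μ := Measure.dirac x) (ν := β)).ae hx)
  have q3 := q.ae ((Measure.quasiMeasurePreserving_snd (μ := Measure.dirac x) (ν := β)).ae hg)
  filter_upwards [q1, q2, q3] with z h1 h2 h3
  rw [h2]
  exact ⟨h1.symm, h3.symm⟩

end DiracProduct

namespace TopGroupoid

section Pullback

variable {S0 S G0 G T0 T : Type*} [TopologicalSpace S0] [TopologicalSpace S]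
  [TopologicalSpace G0] [TopologicalSpace G] [TopologicalSpace T0] [TopologicalSpace T]
  {𝒮 : TopGroupoid S0 S} {𝒢 : TopGroupoid G0 G} {𝒯 : TopGroupoid T0 T}

theorem Hom.continuous_obj (p : Hom 𝒮 𝒢) : Continuous p.obj := by
  have e : p.obj = fun u => 𝒢.r (p.map (𝒮.unit u)) := by
    funext u
    rw [p.r_map, 𝒮.r_unit]
  rw [e]
  exact 𝒢.continuous_r.comp (p.continuous_map.comp 𝒮.continuous_unit)

/-- Associativity: `(p(s)⁻¹ x) q(t) = p(s)⁻¹ (x q(t))`. -/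
theorem val_inv_weakPullback (p : Hom 𝒮 𝒢) (q : Hom 𝒯 𝒢) (z : WPB p q) :
    ((weakPullback p q).inv z).1 = leftInversion p (rightInversion q z.1) := by
  obtain ⟨⟨s, x, t⟩, h1, h2⟩ := z
  have h1 : 𝒢.r x = 𝒢.r (p.map s) := h1
  have h2 : 𝒢.d x = 𝒢.r (q.map t) := h2
  refine Prod.ext rfl (Prod.ext ?_ rfl)
  have k1 : 𝒢.d (𝒢.inv (q.map t)) = 𝒢.r (𝒢.inv x) := by rw [𝒢.d_inv, 𝒢.r_inv, h2]
  have k2 : 𝒢.d (𝒢.inv (p.map s)) = 𝒢.r x := (𝒢.d_inv _).trans h1.symm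
  have e : 𝒢.inv (𝒢.mul (𝒢.inv (q.map t)) (𝒢.inv x) k1) = 𝒢.mul x (q.map t) h2 := by
    rw [𝒢.inv_mul_rev]
    exact 𝒢.mul_congr (𝒢.inv_inv _) (𝒢.inv_inv _) _ _
  change 𝒢.conj (p.map s) x (q.map t) h1 h2 =
    𝒢.mulTotal (𝒢.inv (p.map s)) (𝒢.inv (𝒢.mulTotal (𝒢.inv (q.map t)) (𝒢.inv x)))
  rw [𝒢.mulTotal_eq_mul k1, e, 𝒢.mulTotal_eq_mul (k2.trans (𝒢.r_mul _ _ _).symm)]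
  exact 𝒢.mul_assoc _ _ _ k2 h2

variable [MeasurableSpace G0] [MeasurableSpace G] [BorelSpace G0] [BorelSpace G] [T2Space G0]
  [SecondCountableTopology G0]

theorem measurableSet_wpb0 [MeasurableSpace S0] [MeasurableSpace T0] [BorelSpace S0]
    [BorelSpace T0] (p : Hom 𝒮 𝒢) (q : Hom 𝒯 𝒢) :
    MeasurableSet {v : S0 × G × T0 | 𝒢.r v.2.1 = p.obj v.1 ∧ 𝒢.d v.2.1 = q.obj v.2.2} := by
  have hr := 𝒢.continuous_r.measurable
  have hd := 𝒢.continuous_d.measurable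
  have hp := p.continuous_obj.measurable
  have hq := q.continuous_obj.measurable
  exact (measurableSet_eq_fun (by fun_prop) (by fun_prop)).inter
    (measurableSet_eq_fun (by fun_prop) (by fun_prop))

theorem measurable_wpbEta [MeasurableSpace S0] [MeasurableSpace T0] [BorelSpace S0]
    [BorelSpace T0] (p : Hom 𝒮 𝒢) (q : Hom 𝒯 𝒢) (κ : Kernel G0 S0) (θ : Kernel G0 T0) [IsSFiniteKernel κ] [IsSFiniteKernel θ] : Measurable (wpbEta p q κ θ) := by
  have hemb : MeasurableEmbedding (Subtype.val : WPB0 p q → S0 × G × T0) :=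
    MeasurableEmbedding.subtype_coe (measurableSet_wpb0 p q)
  -- Measurability in `x` comes from recognising a product of kernels, pulled back to a measurable
  -- subset.
  have e : wpbEta p q κ θ = Kernel.comapRight
      ((κ.comap 𝒢.r 𝒢.continuous_r.measurable) ×ₖ
        (Kernel.id ×ₖ (θ.comap 𝒢.d 𝒢.continuous_d.measurable))) hemb := by
    funext x
    simp only [Kernel.comapRight_apply, Kernel.prod_apply, Kernel.comap_apply, Kernel.id_apply]
    rfl
  rw [e]
  exact Kernel.measurable _

variable [MeasurableSpace S] [MeasurableSpace T] [BorelSpace S] [BorelSpace T]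

theorem measurableSet_wpb (p : Hom 𝒮 𝒢) (q : Hom 𝒯 𝒢) :
    MeasurableSet {x : S × G × T | 𝒢.r x.2.1 = 𝒢.r (p.map x.1) ∧
      𝒢.d x.2.1 = 𝒢.r (q.map x.2.2)} := by
  have hr := 𝒢.continuous_r.measurable
  have hd := 𝒢.continuous_d.measurable
  have hp := p.continuous_map.measurable
  have hq := q.continuous_map.measurable
  exact (measurableSet_eq_fun (by fun_prop) (by fun_prop)).inter
    (measurableSet_eq_fun (by fun_prop) (by fun_prop))

variable [MeasurableSpace S0] [MeasurableSpace T0]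

theorem measurable_wpbHaar (p : Hom 𝒮 𝒢) (q : Hom 𝒯 𝒢) (κ : Kernel S0 S) (θ : Kernel T0 T)
    [IsSFiniteKernel κ] [IsSFiniteKernel θ] : Measurable (wpbHaar p q κ θ) := by
  have hemb : MeasurableEmbedding (Subtype.val : WPB p q → S × G × T) :=
    MeasurableEmbedding.subtype_coe (measurableSet_wpb p q)
  have h1 : Measurable fun v : WPB0 p q => v.1.1 := by fun_prop
  have h2 : Measurable fun v : WPB0 p q => v.1.2.1 := by fun_prop
  have h3 : Measurable fun v : WPB0 p q => v.1.2.2 := by fun_prop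
  have e : wpbHaar p q κ θ = Kernel.comapRight
      ((κ.comap _ h1) ×ₖ ((Kernel.id.comap _ h2) ×ₖ (θ.comap _ h3))) hemb := by
    funext x
    simp only [Kernel.comapRight_apply, Kernel.prod_apply, Kernel.comap_apply, Kernel.id_apply]
    rfl
  rw [e]
  exact Kernel.measurable _

variable [BorelSpace S0] [BorelSpace T0]

/-- Integration against the measure on the arrows of the weak pullback. -/
theorem lintegral_wpbMeasure [MeasurableSingletonClass G] (p : Hom 𝒮 𝒢) (q : Hom 𝒯 𝒢)
    (κS : Kernel S0 S) (κT : Kernel T0 T) (γp : Kernel G0 S0) (γq : Kernel G0 T0)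
    [IsSFiniteKernel κS] [IsSFiniteKernel κT] [IsSFiniteKernel γp] [IsSFiniteKernel γq]
    (hS : ∀ u, ∀ᵐ σ ∂κS u, 𝒮.r σ = u) (hT : ∀ u, ∀ᵐ τ ∂κT u, 𝒯.r τ = u)
    (hp : ∀ u, ∀ᵐ s ∂γp u, p.obj s = u) (hq : ∀ u, ∀ᵐ t ∂γq u, q.obj t = u) (μ : Measure G)
    {F : S × G × T → ℝ≥0∞} (hF : Measurable F) :
    ∫⁻ z, F z.1 ∂integratedMeasure (wpbHaar p q κS κT) (wpbUnitMeasure p q γp γq μ) =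
      𝒢.fibredLIntegral μ (κS ∘ₖ γp) (κT ∘ₖ γq) F := by
  have hη := measurable_wpbEta p q γp γq
  have hκ := measurable_wpbHaar p q κS κT
  have hv : ∀ v : WPB0 p q, ∫⁻ z, F z.1 ∂wpbHaar p q κS κT v =
      ∫⁻ σ, ∫⁻ τ, F (σ, v.1.2.1, τ) ∂κT v.1.2.2 ∂κS v.1.1 := by
    intro v
    have h1 : ∀ᵐ σ ∂κS v.1.1, 𝒢.r (p.map σ) = 𝒢.r v.1.2.1 := by
      filter_upwards [hS v.1.1] with σ hσ
      rw [p.r_map, hσ, v.2.1]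
    have h2 : ∀ᵐ τ ∂κT v.1.2.2, 𝒢.r (q.map τ) = 𝒢.d v.1.2.1 := by
      filter_upwards [hT v.1.2.2] with τ hτ
      rw [q.r_map, hτ, v.2.2]
    rw [wpbHaar, lintegral_comap_subtype_val_of_ae (measurableSet_wpb p q)
      (ae_prod_dirac_prod _ _ _ h1 h2), lintegral_prod_dirac_prod _ _ _ hF]
  have hinner : Measurable fun v : S0 × G × T0 =>
      ∫⁻ σ, ∫⁻ τ, F (σ, v.2.1, τ) ∂κT v.2.2 ∂κS v.1 := by
    refine Measurable.lintegral_kernel_comp κS (A := S0 × G × T0) measurable_fst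
      (F := fun v σ => ∫⁻ τ, F (σ, v.2.1, τ) ∂κT v.2.2) ?_
    exact Measurable.lintegral_kernel_comp κT (A := (S0 × G × T0) × S) (g := fun w => w.1.2.2)
      (by fun_prop) (F := fun w τ => F (w.2, w.1.2.1, τ))
      (hF.comp (by fun_prop :
        Measurable fun w : ((S0 × G × T0) × S) × T => (w.1.2, w.1.1.2.1, w.2)))
  have hinner' : Measurable fun v : WPB0 p q =>
      ∫⁻ σ, ∫⁻ τ, F (σ, v.1.2.1, τ) ∂κT v.1.2.2 ∂κS v.1.1 :=
    hinner.comp measurable_subtype_coe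
  have hFv : Measurable fun z : WPB p q => F z.1 := hF.comp measurable_subtype_coe
  rw [integratedMeasure, Measure.lintegral_bind hκ.aemeasurable hFv.aemeasurable]
  simp_rw [hv]
  rw [wpbUnitMeasure, integratedMeasure, Measure.lintegral_bind hη.aemeasurable
    hinner'.aemeasurable]
  refine lintegral_congr fun x => ?_
  rw [wpbEta, lintegral_comap_subtype_val_of_ae
    (F := fun v : S0 × G × T0 => ∫⁻ σ, ∫⁻ τ, F (σ, v.2.1, τ) ∂κT v.2.2 ∂κS v.1)
    (measurableSet_wpb0 p q) (ae_prod_dirac_prod _ _ _ (hp _) (hq _)),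
    lintegral_prod_dirac_prod _ _ _ hinner]
  have hFx : Measurable fun w : S × T => F (w.1, x, w.2) :=
    hF.comp (by fun_prop : Measurable fun w : S × T => (w.1, x, w.2))
  have hσ : Measurable fun σ => ∫⁻ τ, F (σ, x, τ) ∂(κT ∘ₖ γq) (𝒢.d x) :=
    Measurable.lintegral_prod_right' hFx
  rw [Kernel.lintegral_comp _ _ _ hσ]
  refine lintegral_congr fun s => ?_
  have hFt : Measurable fun w : T0 × S => ∫⁻ τ, F (w.2, x, τ) ∂κT w.1 :=
    Measurable.lintegral_kernel_comp κT (A := T0 × S) measurable_fst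
      (F := fun w τ => F (w.2, x, τ))
      (hF.comp (by fun_prop : Measurable fun w : (T0 × S) × T => (w.1.2, x, w.2)))
  -- Exchanging `t` and `σ` groups each unit with its arrow, as the composed kernels require.
  refine (lintegral_lintegral_swap (μ := γq (𝒢.d x)) (ν := κS s)
    (f := fun t σ => ∫⁻ τ, F (σ, x, τ) ∂κT t)
    hFt.aemeasurable).trans (lintegral_congr fun σ => ?_)
  have hτ : Measurable fun τ : T => F (σ, x, τ) :=
    hF.comp (by fun_prop : Measurable fun τ : T => (σ, x, τ))
  exact (Kernel.lintegral_comp _ _ _ hτ).symm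

end Pullback

end TopGroupoid

/-! ### Quasi-invariance and the modular function of the weak pullback -/

theorem Set.indicator_image_subtype_val {A M : Type*} [Zero M] {P : A → Prop}
    (E : Set {a // P a}) (c : M) (z : {a // P a}) :
    (Subtype.val '' E).indicator (fun _ => c) z.1 = E.indicator (fun _ => c) z := by
  classical
  simp only [indicator_apply, Subtype.val_injective.mem_set_image]

namespace TopGroupoid

section WeakPullbackQuasiInvariance

variable {S0 S G0 G T0 T : Type*} [TopologicalSpace S0] [TopologicalSpace S]
  [TopologicalSpace G0] [TopologicalSpace G] [TopologicalSpace T0] [TopologicalSpace T]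
  {𝒮 : TopGroupoid S0 S} {𝒢 : TopGroupoid G0 G} {𝒯 : TopGroupoid T0 T}

theorem ae_r_map_comp [MeasurableSpace S0] [MeasurableSpace S] [MeasurableSpace G0]
    [BorelSpace S] [BorelSpace G0] [T2Space G0] [SecondCountableTopology G0] (p : Hom 𝒮 𝒢)
    {κ : Kernel S0 S} {γ : Kernel G0 S0} (hκ : ∀ u, ∀ᵐ σ ∂κ u, 𝒮.r σ = u)
    (hγ : ∀ u, ∀ᵐ s ∂γ u, p.obj s = u) (u : G0) : ∀ᵐ σ ∂(κ ∘ₖ γ) u, 𝒢.r (p.map σ) = u := by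
  refine Kernel.ae_comp_of_ae_ae (measurableSet_eq_fun
    (𝒢.continuous_r.comp p.continuous_map).measurable measurable_const) ?_
  filter_upwards [hγ u] with s hs
  filter_upwards [hκ s] with σ hσ
  rw [p.r_map, hσ, hs]

variable [MeasurableSpace S] [MeasurableSpace G0] [MeasurableSpace G] [MeasurableSpace T]
  [BorelSpace S] [BorelSpace G0] [BorelSpace G] [BorelSpace T] [T2Space G0]
  [SecondCountableTopology G0]

theorem quasiInvariant_weakPullback_of_lintegral [SecondCountableTopology G]
    (p : Hom 𝒮 𝒢) (q : Hom 𝒯 𝒢)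
    {μ : Measure (WPB p q)} {Λ : Kernel G0 G} {κ : Kernel G0 S} {θ : Kernel G0 T}
    [IsSFiniteKernel Λ] [IsSFiniteKernel κ] [IsSFiniteKernel θ] {μ0 : Measure G0}
    (hμ : ∀ F : S × G × T → ℝ≥0∞, Measurable F →
      ∫⁻ z, F z.1 ∂μ = 𝒢.fibredLIntegral (μ0.bind Λ) κ θ F)
    (hΛ : ∀ u, ∀ᵐ x ∂Λ u, 𝒢.r x = u) (hκ : ∀ u, ∀ᵐ σ ∂κ u, 𝒢.r (p.map σ) = u)
    (hθ : ∀ u, ∀ᵐ τ ∂θ u, 𝒢.r (q.map τ) = u)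
    (hinv : ∀ a, (Λ (𝒢.r a)).map (𝒢.mulTotal (𝒢.inv a)) = Λ (𝒢.d a))
    (hS : MeasureEquivalent (μ0.bind κ) (𝒮.invMeasure (μ0.bind κ)))
    (hG : MeasureEquivalent (μ0.bind Λ) (𝒢.invMeasure (μ0.bind Λ)))
    (hT : MeasureEquivalent (μ0.bind θ) (𝒯.invMeasure (μ0.bind θ)))
    (hinvm : Measurable (weakPullback p q).inv) :
    MeasureEquivalent μ ((weakPullback p q).invMeasure μ) := by
  have hemb : MeasurableEmbedding (Subtype.val : WPB p q → S × G × T) :=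
    MeasurableEmbedding.subtype_coe (measurableSet_wpb p q)
  have key : ∀ E : Set (WPB p q), MeasurableSet E →
      ((weakPullback p q).invMeasure μ E = 0 ↔ μ E = 0) := by
    intro E hE
    have hE' := hemb.measurableSet_image.2 hE
    have hF : Measurable ((Subtype.val '' E).indicator fun _ : S × G × T => (1 : ℝ≥0∞)) :=
      measurable_const.indicator hE'
    have hL := measurable_leftInversion (T := T) p
    have e : ∀ z : WPB p q, (Subtype.val '' E).indicator (fun _ => (1 : ℝ≥0∞)) z.1 =
        E.indicator (fun _ => 1) z :=
      Set.indicator_image_subtype_val E 1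
    have h1 : μ E = ∫⁻ z, (Subtype.val '' E).indicator (fun _ => 1) z.1 ∂μ := by
      simp_rw [e]
      exact (lintegral_indicator_one hE).symm
    have h2 : (weakPullback p q).invMeasure μ E = ∫⁻ z, (((Subtype.val '' E).indicator
        (fun _ => 1)) ∘ leftInversion p ∘ rightInversion q) z.1 ∂μ := by
      rw [← lintegral_indicator_one hE, invMeasure,
        lintegral_map (measurable_one.indicator hE) hinvm]
      refine lintegral_congr fun z => ?_
      simp only [Function.comp_apply]
      rw [← val_inv_weakPullback, e]
      rfl
    -- The right inversion is stripped first, then the left one, each preserving vanishing of the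
    -- integral.
    rw [h1, h2, hμ _ hF, hμ _ (hF.comp (hL.comp (measurable_rightInversion q))),
      ← Function.comp_assoc,
      fibredLIntegral_comp_rightInversion_eq_zero_iff q hΛ hθ hinv hT hG (hF.comp hL),
      fibredLIntegral_comp_leftInversion_eq_zero_iff p hΛ hκ hinv hS hF]
  exact ⟨Measure.AbsolutelyContinuous.mk fun E hE h => (key E hE).1 h,
    Measure.AbsolutelyContinuous.mk fun E hE h => (key E hE).2 h⟩

theorem isModularFunction_weakPullback_of_lintegral [SecondCountableTopology G]
    (p : Hom 𝒮 𝒢) (q : Hom 𝒯 𝒢)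
    {μ : Measure (WPB p q)} {Λ : Kernel G0 G} {κ : Kernel G0 S} {θ : Kernel G0 T}
    [IsSFiniteKernel Λ] [IsSFiniteKernel κ] [IsSFiniteKernel θ] {μ0 : Measure G0}
    (hμ : ∀ F : S × G × T → ℝ≥0∞, Measurable F →
      ∫⁻ z, F z.1 ∂μ = 𝒢.fibredLIntegral (μ0.bind Λ) κ θ F)
    (hΛ : ∀ u, ∀ᵐ x ∂Λ u, 𝒢.r x = u) (hκ : ∀ u, ∀ᵐ σ ∂κ u, 𝒢.r (p.map σ) = u)
    (hθ : ∀ u, ∀ᵐ τ ∂θ u, 𝒢.r (q.map τ) = u)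
    (hinv : ∀ a, (Λ (𝒢.r a)).map (𝒢.mulTotal (𝒢.inv a)) = Λ (𝒢.d a))
    (hinvm : Measurable (weakPullback p q).inv) {ΔS : S → ℝ} {ΔG : G → ℝ} {ΔT : T → ℝ}
    (hS : 𝒮.IsModularFunction (μ0.bind κ) ΔS) (hG : 𝒢.IsModularFunction (μ0.bind Λ) ΔG)
    (hT : 𝒯.IsModularFunction (μ0.bind θ) ΔT) :
    (weakPullback p q).IsModularFunction μ
      fun x => ΔS x.1.1 * ΔT x.1.2.2 / ΔG (q.map x.1.2.2) := by
  have hSm := hS.measurable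
  have hTm := hT.measurable
  have hGm : Measurable fun t => ΔG (q.map t) :=
    hG.measurable.comp q.continuous_map.measurable
  have hΔ : Measurable fun z : S × G × T => ΔS z.1 * ΔT z.2.2 / ΔG (q.map z.2.2) := by
    have h1 : Measurable fun z : S × G × T => z.2.2 := by fun_prop
    exact ((hSm.comp measurable_fst).mul (hTm.comp h1)).div (hGm.comp h1)
  refine ⟨hΔ.comp measurable_subtype_coe, fun x => div_pos (mul_pos (hS.pos _) (hT.pos _))
    (hG.pos _), fun x y h => ?_, ?_⟩
  · have hs : 𝒮.d x.1.1 = 𝒮.r y.1.1 := congrArg (fun v => v.1.1) h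
    have ht : 𝒯.d x.1.2.2 = 𝒯.r y.1.2.2 := congrArg (fun v => v.1.2.2) h
    change ΔS (𝒮.mul x.1.1 y.1.1 hs) * ΔT (𝒯.mul x.1.2.2 y.1.2.2 ht) /
      ΔG (q.map (𝒯.mul x.1.2.2 y.1.2.2 ht)) = _
    rw [hS.map_mul, hT.map_mul, q.map_mul, hG.map_mul]
    have := (hG.pos (q.map x.1.2.2)).ne'
    have := (hG.pos (q.map y.1.2.2)).ne'
    field_simp
  · have hemb : MeasurableEmbedding (Subtype.val : WPB p q → S × G × T) :=
      MeasurableEmbedding.subtype_coe (measurableSet_wpb p q)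
    have hL := measurable_leftInversion (T := T) p
    have hR := measurable_rightInversion (S := S) q
    ext E hE
    have hE' := hemb.measurableSet_image.2 hE
    set F : S × G × T → ℝ≥0∞ := (Subtype.val '' E).indicator fun _ => 1
    have hF : Measurable F := measurable_const.indicator hE'
    have e : ∀ z : WPB p q, F z.1 = E.indicator (fun _ => 1) z :=
      Set.indicator_image_subtype_val E 1
    set H : S × G × T → ℝ≥0∞ :=
      fun z => ENNReal.ofReal (ΔS z.1 * ΔT z.2.2 / ΔG (q.map z.2.2)) * F z with hHdef
    have hH : Measurable H := hΔ.ennreal_ofReal.mul hF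
    have h1 : μ E = ∫⁻ z, F z.1 ∂μ := by
      simp_rw [e]
      exact (lintegral_indicator_one hE).symm
    have h2 : ((weakPullback p q).invMeasure μ).withDensity (fun x : WPB p q =>
        ENNReal.ofReal (ΔS x.1.1 * ΔT x.1.2.2 / ΔG (q.map x.1.2.2))) E =
        ∫⁻ z, (H ∘ leftInversion p ∘ rightInversion q) z.1 ∂μ := by
      have hHv : Measurable fun z : WPB p q => H z.1 := hH.comp measurable_subtype_coe
      rw [withDensity_apply _ hE, ← lintegral_indicator hE]
      calc _ = ∫⁻ z, H z.1 ∂(weakPullback p q).invMeasure μ := by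
            refine lintegral_congr fun z => ?_
            rw [hHdef]
            simp only [e]
            by_cases hz : z ∈ E
            · simp [hz]
            · simp [hz]
        _ = _ := by
            rw [invMeasure, lintegral_map hHv hinvm]
            refine lintegral_congr fun z => ?_
            rw [val_inv_weakPullback]
            rfl
    have hSF : Measurable fun z : S × G × T => ENNReal.ofReal (ΔS z.1) * F z :=
      (hSm.ennreal_ofReal.comp measurable_fst).mul hF
    rw [h1, h2, hμ _ hF, hμ _ (hH.comp (hL.comp hR)),
      fibredLIntegral_eq_comp_leftInversion p hΛ hκ hinv hSm.ennreal_ofReal hS.density hF,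
      fibredLIntegral_eq_comp_rightInversion q hΛ hκ hθ hinv hT hG (hSF.comp hL)]
    -- The factor for `T` is evaluated at `R z` and the one for `S` at `L (R z)`. Since `L` fixes
    -- the third coordinate, both are values at the inverse arrow and multiply to `Δ_P` there.
    congr 1
    funext z
    simp only [Function.comp_apply, hHdef]
    rw [← _root_.mul_assoc]
    congr 1
    rw [← ENNReal.ofReal_mul (div_pos (hT.pos _) (hG.pos _)).le, mul_comm, ← mul_div_assoc]
    rfl

end WeakPullbackQuasiInvariance

end TopGroupoid

/-! ### The theorem for Haar groupoids -/

theorem IsLocallyBoundedDisintegration.eq_bind {X Y : Type*} [TopologicalSpace X]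
    [MeasurableSpace X] [MeasurableSpace Y] {π : X → Y} {γ : Y → Measure X} {μ : Measure X}
    {ν : Measure Y} (h : IsLocallyBoundedDisintegration π γ μ ν) : μ = ν.bind h.borel.kernel := by
  ext E hE
  rw [h.disintegration E hE, Measure.bind_apply hE (Kernel.measurable _).aemeasurable]
  rfl

open TopGroupoid in
theorem mainTheorem2 {S0 S G0 G T0 T : Type*}
    [TopologicalSpace S0] [MeasurableSpace S0] [BorelSpace S0]
    [TopologicalSpace S] [MeasurableSpace S] [BorelSpace S]
    [SecondCountableTopology S] [LocallyCompactSpace S] [T2Space S]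
    [TopologicalSpace G0] [MeasurableSpace G0] [BorelSpace G0]
    [TopologicalSpace G] [MeasurableSpace G] [BorelSpace G]
    [SecondCountableTopology G] [LocallyCompactSpace G] [T2Space G]
    [TopologicalSpace T0] [MeasurableSpace T0] [BorelSpace T0]
    [TopologicalSpace T] [MeasurableSpace T] [BorelSpace T]
    [SecondCountableTopology T] [LocallyCompactSpace T] [T2Space T]
    (𝒮 : TopGroupoid S0 S) (𝒢 : TopGroupoid G0 G) (𝒯 : TopGroupoid T0 T)
    (lamS : S0 → Measure S) (μS0 : Measure S0) (hS : 𝒮.IsHaarGroupoid lamS μS0)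
    (lamG : G0 → Measure G) (μG0 : Measure G0) (hG : 𝒢.IsHaarGroupoid lamG μG0)
    (lamT : T0 → Measure T) (μT0 : Measure T0) (hT : 𝒯.IsHaarGroupoid lamT μT0)
    (p : TopGroupoid.Hom 𝒮 𝒢) (q : TopGroupoid.Hom 𝒯 𝒢)
    (hp : MeasureEquivalent ((integratedMeasure lamS μS0).map p.map)
      (integratedMeasure lamG μG0))
    (hq : MeasureEquivalent ((integratedMeasure lamT μT0).map q.map)
      (integratedMeasure lamG μG0))
    (γp : G0 → Measure S0) (hγp : IsLocallyBoundedDisintegration p.obj γp μS0 μG0)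
    (γq : G0 → Measure T0) (hγq : IsLocallyBoundedDisintegration q.obj γq μT0 μG0) :
    let P := TopGroupoid.weakPullback p q
    let μG := integratedMeasure lamG μG0
    let η := TopGroupoid.wpbEta p q γp γq
    let μP0 := TopGroupoid.wpbUnitMeasure p q γp γq μG
    let lamP := TopGroupoid.wpbHaar p q lamS lamT
    let μP := integratedMeasure lamP μP0
    (∀ B, MeasurableSet B → μP0 B = ∫⁻ x, η x B ∂μG) ∧
    (∀ E, MeasurableSet E → μP E = ∫⁻ v, lamP v E ∂μP0) ∧
    P.QuasiInvariant lamP μP0 ∧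
    ∀ (ΔS : S → ℝ) (ΔG : G → ℝ) (ΔT : T → ℝ),
      𝒮.IsModularFunction (integratedMeasure lamS μS0) ΔS →
      𝒢.IsModularFunction μG ΔG →
      𝒯.IsModularFunction (integratedMeasure lamT μT0) ΔT →
      P.IsModularFunction μP
        (fun x => ΔS x.1.1 * ΔT x.1.2.2 / ΔG (q.map x.1.2.2)) := by
  have : T2Space S0 := 𝒮.isEmbedding_unit.t2Space
  have : T2Space G0 := 𝒢.isEmbedding_unit.t2Space
  have : T2Space T0 := 𝒯.isEmbedding_unit.t2Space
  have : SecondCountableTopology S0 := 𝒮.isEmbedding_unit.secondCountableTopology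
  have : SecondCountableTopology G0 := 𝒢.isEmbedding_unit.secondCountableTopology
  have : SecondCountableTopology T0 := 𝒯.isEmbedding_unit.secondCountableTopology
  have bS := hS.haar.continuous.isBorelSystem
  have bG := hG.haar.continuous.isBorelSystem
  have bT := hT.haar.continuous.isBorelSystem
  have := hS.haar.continuous.isSFiniteKernel bS
  have := hG.haar.continuous.isSFiniteKernel bG
  have := hT.haar.continuous.isSFiniteKernel bT
  have := hγp.borel.isSFiniteKernel_of_isLocallyBoundedSystem hγp.locallyBounded
  have := hγq.borel.isSFiniteKernel_of_isLocallyBoundedSystem hγq.locallyBounded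
  have hΛ : ∀ u, ∀ᵐ x ∂bG.kernel u, 𝒢.r x = u := hG.haar.system
  have hκ := ae_r_map_comp p (κ := bS.kernel) (γ := hγp.borel.kernel) hS.haar.system hγp.system
  have hθ := ae_r_map_comp q (κ := bT.kernel) (γ := hγq.borel.kernel) hT.haar.system hγq.system
  have hinv : ∀ a, (bG.kernel (𝒢.r a)).map (𝒢.mulTotal (𝒢.inv a)) = bG.kernel (𝒢.d a) :=
    hG.haar.map_mulTotal_inv
  -- The disintegration enters here: `μ_S` is fibred over the units of `G` by the composed kernel.
  have dS : integratedMeasure lamS μS0 = μG0.bind (bS.kernel ∘ₖ hγp.borel.kernel) := by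
    rw [← Measure.comp_assoc, ← hγp.eq_bind]
    rfl
  have dT : integratedMeasure lamT μT0 = μG0.bind (bT.kernel ∘ₖ hγq.borel.kernel) := by
    rw [← Measure.comp_assoc, ← hγq.eq_bind]
    rfl
  have hη : Measurable (wpbEta p q γp γq) :=
    measurable_wpbEta p q hγp.borel.kernel hγq.borel.kernel
  have hlam : Measurable (wpbHaar p q lamS lamT) :=
    measurable_wpbHaar p q bS.kernel bT.kernel
  have hinvm : Measurable (weakPullback p q).inv := (weakPullback p q).continuous_inv.measurable
  have hμ : ∀ F : S × G × T → ℝ≥0∞, Measurable F →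
      ∫⁻ z, F z.1 ∂integratedMeasure (wpbHaar p q lamS lamT)
        (wpbUnitMeasure p q γp γq (integratedMeasure lamG μG0)) =
      𝒢.fibredLIntegral (μG0.bind bG.kernel) (bS.kernel ∘ₖ hγp.borel.kernel)
        (bT.kernel ∘ₖ hγq.borel.kernel) F := fun F hF =>
    lintegral_wpbMeasure p q bS.kernel bT.kernel hγp.borel.kernel hγq.borel.kernel
      hS.haar.system hT.haar.system hγp.system hγq.system (integratedMeasure lamG μG0) hF
  have qS := hS.quasiInvariant
  have qT := hT.quasiInvariant
  rw [QuasiInvariant, dS] at qS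
  rw [QuasiInvariant, dT] at qT
  refine ⟨fun B hB => Measure.bind_apply hB hη.aemeasurable,
    fun E hE => Measure.bind_apply hE hlam.aemeasurable,
    quasiInvariant_weakPullback_of_lintegral p q hμ hΛ hκ hθ hinv qS hG.quasiInvariant qT hinvm,
    fun ΔS ΔG ΔT mS mG mT => ?_⟩
  rw [dS] at mS
  rw [dT] at mT
  exact isModularFunction_weakPullback_of_lintegral p q hμ hΛ hκ hθ hinv hinvm mS mG mT
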